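/- Let $V=\{k\in\mathbb R^4: k^0>0,\ k_\alpha k^\alpha>0\}$ be the open future cone (signature $(+,-,-,-)$), and let $\mu=(k_\alpha k^\alpha)^{1/2}$, $\mu'=(k'_\alpha k'^\alpha)^{1/2}$. For $j\in\{0,\frac12,1,\dots\}$, $m\in\{-j,\dots,j\}$ and $\sigma$ in a countable set $S$, let $A_{j\sigma}\subset\mathbb R$ be a measurable set, and let $\mathcal H'$ be the Hilbert space of the wave functions $\psi_{\sigma jm}(k)$ on $V$, vanishing unless $\mu\in A_{j\sigma}$, with $\|\psi\|^2=\int_V\sum_{\sigma jm}|\psi_{\sigma jm}(k)|^2\,d^4k<\infty$. Let $\mathcal H'$ be a closed subspace of a Hilbert space $\mathcal H$. Let $k\mapsto a_k\in SL(2,\mathbb C)$ be measurable with $\Lambda(a_k)(\mu,0,0,0)=k$ for $k\in V$. Let $D^{jc}_{jm'jm}(a)$ be the matrix elements, between the vectors of $SU(2)$-spin $j$, of the unitary principal series representation of $SL(2,\mathbb C)$ with $M=j$, $c=0$ if $j>0$, and of the trivial representation ($D=1$) if $j=0$. Let $F^j_{\nu\sigma}(\mu)$, with $\nu$ in a countable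 set, be measurable functions such that, for almost all $\mu>0$, $\sum_\nu|\sum_\sigma F^j_{\nu\sigma}(\mu)c_\sigma|^2\le\sum_\sigma|c_\sigma|^2$ for all $c$ with $c_\sigma=0$ whenever $\mu\notin A_{j\sigma}$. Let $\tau$ be a positive-operator-valued measure on the Borel sets of $\mathbb R^4$ with values in the bounded operators on $\mathcal H$, with $\tau(\mathbb R^4)\le1$, which vanishes on the orthogonal complement of $\mathcal H'$ and is quasi-baricentric, that is, $(\psi,\tau(I)\psi)=\int_I\rho(\psi,x)\,d^4x$ with $$\rho(\psi,x)=(2\pi)^{-4}\int_V\int_V e^{ix_\alpha(k'^\alpha-k^\alpha)}\sum_{\nu j\sigma'm'\sigma m}D^{jc}_{jm'jm}(a_{k'}^{-1}a_k)\,\overline{F^j_{\nu\sigma'}(\mu')}\,F^j_{\nu\sigma}(\mu)\,\overline{\psi_{\sigma'jm'}(k')}\,\psi_{\sigma jm}(k)\,d^4k'\,d^4k$$ for all $\psi\in\mathcal H'$ with finitely many non-zero components, all of them integrable (these $\psi$ are dense in $\mathcal H'$, so the formula determines $\tau$, which is automatically Poincaré covariant). Suppose that for some $j$ there are measurable functions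 $c_\sigma(\mu)$, with $c_\sigma(\mu)=0$ for $\mu\notin A_{j\sigma}$ and $\sum_\sigma|c_\sigma(\mu)|^2=1$ for all sufficiently large $\mu$, such that $$\hat r(\mu',\mu)=\sum_{\nu\sigma'\sigma}\overline{F^j_{\nu\sigma'}(\mu')}\,F^j_{\nu\sigma}(\mu)\,\overline{c_{\sigma'}(\mu')}\,c_\sigma(\mu)$$ satisfies $\lim_{\mu\to+\infty}\hat r(\mu,\mu+t)=1$ uniformly for $t$ in any bounded interval of the real line. Then $\tau$ is definite: $\|\tau(I)\|=1$ for every Borel set $I\subset\mathbb R^4$ with non-empty interior. -/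

import Mathlib

open MeasureTheory Filter Topology
open scoped ENNReal ComplexConjugate

noncomputable section

namespace EventPOV

/-! ## Positive-operator-valued measures -/

/-- A bounded positive-operator-valued measure on the measurable subsets of `X`, with values in the
bounded operators of the Hilbert space `H`: the operators are positive, `τ(X) ≤ 1`, and
`I ↦ ⟪φ, τ(I) ψ⟫` is countably additive. (Values on non-measurable sets carry no meaning.) -/
structure POVMeasure (X : Type*) [MeasurableSpace X] (H : Type*) [NormedAddCommGroup H]
    [InnerProductSpace ℂ H] [CompleteSpace H] where
  /-- the operator `τ(I)` -/
  op : Set X → H →L[ℂ] H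
  isPositive : ∀ I, MeasurableSet I → (op I).IsPositive
  univ_le_one : ((1 : H →L[ℂ] H) - op Set.univ).IsPositive
  hasSum_iUnion : ∀ I : ℕ → Set X, (∀ n, MeasurableSet (I n)) →
    Pairwise (Function.onFun Disjoint I) → ∀ φ ψ : H,
      HasSum (fun n => inner ℂ φ (op (I n) ψ)) (inner ℂ φ (op (⋃ n, I n) ψ))

/-- A POV measure is definite if `‖τ(I)‖ = 1` for each Borel set with non-empty interior. -/
def POVMeasure.IsDefinite {X : Type*} [TopologicalSpace X] [MeasurableSpace X] {H : Type*}
    [NormedAddCommGroup H] [InnerProductSpace ℂ H] [CompleteSpace H] (τ : POVMeasure X H) : Prop :=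
  ∀ I : Set X, MeasurableSet I → (interior I).Nonempty → ‖τ.op I‖ = 1

/-! ## Minkowski space -/

/-- Four-vectors, with coordinates `0, 1, 2, 3`; used both for space-time and for momentum space.
The measure on it is the Lebesgue measure. -/
abbrev FourVector : Type := Fin 4 → ℝ

/-- The Lorentz product `x_α k^α`, with signature `(+,-,-,-)`. -/
def lorentzDot (x k : FourVector) : ℝ := x 0 * k 0 - x 1 * k 1 - x 2 * k 2 - x 3 * k 3

/-- The open future cone `V`. -/
def futureCone : Set FourVector := {k | 0 < k 0 ∧ 0 < lorentzDot k k}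

/-- The mass `μ = (k_α k^α)^{1/2}`. -/
def mass (k : FourVector) : ℝ := Real.sqrt (lorentzDot k k)

/-- The Hermitian matrix `k⁰ + k¹σ¹ + k²σ² + k³σ³`. The Lorentz matrix `Λ(a)` of `a ∈ SL(2, ℂ)` is
defined by `spinorMatrix (Λ(a) k) = a * spinorMatrix k * aᴴ`. -/
def spinorMatrix (k : FourVector) : Matrix (Fin 2) (Fin 2) ℂ :=
  !![(k 0 : ℂ) + k 3, (k 1 : ℂ) - Complex.I * k 2;
     (k 1 : ℂ) + Complex.I * k 2, (k 0 : ℂ) - k 3]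

/-- The momentum at rest `q(μ) = (μ, 0, 0, 0)`. -/
def restMomentum (μ : ℝ) : FourVector := ![μ, 0, 0, 0]

/-! ## Matrix elements of the representations `D^{j c}` of `SL(2, ℂ)`

Spins `j ∈ {0, 1/2, 1, …}` are coded by `J = 2j : ℕ`, and `m ∈ {-j, …, j}` by `j + m : Fin (J + 1)`.

For `j > 0` the representation `D^{j 0}` of the principal series (`M = j`, `c = 0`) acts by
`(T_a f)(z) = f(z a)` on the functions `f` on `ℂ² ∖ {0}` with
`f(λ z) = |λ|⁻² (λ/|λ|)^{2j} f(z)`, with the invariant scalar product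
`π⁻¹ ∫_ℂ conj (f(ζ, 1)) g(ζ, 1) d²ζ`. -/

/-- The scalar product of the principal series. -/
def principalInner (f g : (Fin 2 → ℂ) → ℂ) : ℂ :=
  (Real.pi : ℂ)⁻¹ * ∫ ζ : ℂ, conj (f ![ζ, 1]) * g ![ζ, 1]

/-- The action `(T_a f)(z) = f(z a)` of `SL(2, ℂ)`. -/
def principalAction (a : Matrix.SpecialLinearGroup (Fin 2) ℂ) (f : (Fin 2 → ℂ) → ℂ) :
    (Fin 2 → ℂ) → ℂ :=
  fun z => f (Matrix.vecMul z (a : Matrix (Fin 2) (Fin 2) ℂ))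

/-- The orthonormal basis of the subspace of `D^{j 0}` on which `SU(2)` acts by its irreducible
representation of spin `j`, namely the functions
`((2j+1)! / ((j+m)! (j-m)!))^{1/2} z₁^{j+m} z₂^{j-m} |z|^{-2j-2}`. -/
def principalVector (J : ℕ) (m : Fin (J + 1)) (z : Fin 2 → ℂ) : ℂ :=
  (Real.sqrt ((J + 1).factorial / ((m : ℕ).factorial * (J - (m : ℕ)).factorial)) : ℂ) *
    z 0 ^ (m : ℕ) * z 1 ^ (J - (m : ℕ)) /
      ((Real.sqrt (‖z 0‖ ^ 2 + ‖z 1‖ ^ 2) ^ (J + 2) : ℝ) : ℂ)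

/-- The matrix element `D^{j c}_{j m' j m}(a)`, where `c = 0` for `j > 0`, while for `j = 0` the
representation is the trivial one-dimensional one (`c = 1`). -/
def repD (J : ℕ) (a : Matrix.SpecialLinearGroup (Fin 2) ℂ) (m' m : Fin (J + 1)) : ℂ :=
  if J = 0 then 1
  else principalInner (principalVector J m') (principalAction a (principalVector J m))

/-! ## Quasi-baricentric POV measures -/

/-- The labels `(j, σ, m)` of the components of the wave functions. -/
abbrev Label (S : Type*) : Type _ := Σ J : ℕ, S × Fin (J + 1)

/-- The quantities that enter in the quasi-baricentric density. `S` is the set of the values of the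
index `σ`, and `N` of the index `ν`. -/
structure QuasiBaricentricData (S N : Type*) where
  /-- The masses for which the component `ψ_{σ j m}` of the wave functions is defined. -/
  spectrum : ℕ → S → Set ℝ
  measurableSet_spectrum : ∀ J σ, MeasurableSet (spectrum J σ)
  /-- The coefficients `F^j_{ν σ}(μ)`. -/
  F : ℕ → N → S → ℝ → ℂ
  measurable_F : ∀ J ν σ, Measurable (F J ν σ)
  /-- For almost all masses, `∑_ν |∑_σ F^j_{νσ}(μ) c_σ|² ≤ ∑_σ |c_σ|²` for the vectors `c` of the
  multiplicity space at mass `μ` (a finite number of non-zero components suffices). -/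
  contraction : ∀ J, ∀ᵐ μ ∂(volume.restrict (Set.Ioi (0 : ℝ))), ∀ c : S →₀ ℂ,
    (∀ σ ∈ c.support, μ ∈ spectrum J σ) →
      ∑' ν, ‖∑ σ ∈ c.support, F J ν σ μ * c σ‖ₑ ^ 2 ≤ ∑ σ ∈ c.support, ‖c σ‖ₑ ^ 2
  /-- The chosen elements `a_k ∈ SL(2, ℂ)`. -/
  boost : FourVector → Matrix.SpecialLinearGroup (Fin 2) ℂ
  measurable_boost : ∀ i i', Measurable fun k => (boost k : Matrix (Fin 2) (Fin 2) ℂ) i i'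
  /-- `Λ(a_k) q(μ) = k` for all `k` in the open future cone. -/
  boost_rest : ∀ k ∈ futureCone,
    (boost k : Matrix (Fin 2) (Fin 2) ℂ) * spinorMatrix (restMomentum (mass k)) *
      (boost k : Matrix (Fin 2) (Fin 2) ℂ).conjTranspose = spinorMatrix k

namespace QuasiBaricentricData

variable {S N : Type*} (Q : QuasiBaricentricData S N)

/-- The region of the open future cone in which a component of the wave function is defined. -/
def region (i : Label S) : Set FourVector := {k ∈ futureCone | mass k ∈ Q.spectrum i.1 i.2.1}

/-- The Hilbert space `ℋ'` of the wave functions `ψ_{σ j m}(k)`, with the norm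
`‖ψ‖² = ∑_{σ j m} ∫ |ψ_{σ j m}(k)|² d⁴k`. -/
abbrev WaveSpace : Type _ :=
  lp (fun i : Label S => Lp ℂ 2 (volume.restrict (Q.region i))) 2

/-- The component `ψ_{σ j m}(k)`, put equal to zero outside the region where it is defined. -/
def component (ψ : Q.WaveSpace) (J : ℕ) (σ : S) (m : Fin (J + 1)) : FourVector → ℂ :=
  (Q.region ⟨J, σ, m⟩).indicator (ψ ⟨J, σ, m⟩ : FourVector → ℂ)

/-- The wave functions with a finite number of non-zero components, all of them integrable. They
form a dense subspace, invariant under translations and Lorentz transformations, on which the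
integrals and the sums in the density converge absolutely. -/
def IsRegular (ψ : Q.WaveSpace) : Prop :=
  {i : Label S | ψ i ≠ 0}.Finite ∧
    ∀ i : Label S, Integrable (ψ i : FourVector → ℂ) (volume.restrict (Q.region i))

/-- The quasi-baricentric density
`ρ(ψ, x) = (2π)⁻⁴ ∫_V ∫_V exp(i x_α (k'^α - k^α)) ∑_{ν j σ' m' σ m} D^{jc}_{jm'jm}(a_{k'}⁻¹ a_k)
  conj(F^j_{νσ'}(μ')) F^j_{νσ}(μ) conj(ψ_{σ'jm'}(k')) ψ_{σjm}(k) d⁴k' d⁴k`. -/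
def density (ψ : Q.WaveSpace) (x : FourVector) : ℂ :=
  ((2 * Real.pi) ^ 4 : ℂ)⁻¹ *
    ∫ k' in futureCone, ∫ k in futureCone,
      Complex.exp (Complex.I * (lorentzDot x (k' - k) : ℝ)) *
        ∑' (ν : N) (J : ℕ) (σ' : S), ∑ m' : Fin (J + 1), ∑' σ : S, ∑ m : Fin (J + 1),
          repD J ((Q.boost k')⁻¹ * Q.boost k) m' m *
            conj (Q.F J ν σ' (mass k')) * Q.F J ν σ (mass k) *
              conj (Q.component ψ J σ' m' k') * Q.component ψ J σ m k

/-- `τ` is the quasi-baricentric POV measure on the Minkowski space-time described by the data `Q`.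
The isometry `W` identifies the subspace `ℋ'` of `H`, on which the momentum spectrum is
absolutely continuous, with the space of wave functions. On `ℋ'` the density of `τ` is the
quasi-baricentric one, and `τ` vanishes on the orthogonal complement of `ℋ'`. The covariance with
respect to the Poincaré group is a consequence of this form of the density. -/
structure Describes {H : Type*} [NormedAddCommGroup H] [InnerProductSpace ℂ H] [CompleteSpace H]
    (W : Q.WaveSpace →ₗᵢ[ℂ] H) (τ : POVMeasure FourVector H) : Prop where
  integrable_density : ∀ ψ, Q.IsRegular ψ → Integrable (Q.density ψ)
  inner_eq : ∀ ψ, Q.IsRegular ψ → ∀ I, MeasurableSet I →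
    inner ℂ (W ψ) (τ.op I (W ψ)) = ∫ x in I, Q.density ψ x
  eq_zero : ∀ χ : H, (∀ ψ, inner ℂ (W ψ) χ = 0) → ∀ I, MeasurableSet I → τ.op I χ = 0

/-- `r̂(μ', μ) = ∑_{ν σ' σ} conj(F^j_{νσ'}(μ')) F^j_{νσ}(μ) conj(c_{σ'}(μ')) c_σ(μ)`. -/
def rHat (J : ℕ) (c : S → ℝ → ℂ) (μ' μ : ℝ) : ℂ :=
  ∑' (ν : N) (σ' : S) (σ : S),
    conj (Q.F J ν σ' μ') * Q.F J ν σ μ * conj (c σ' μ') * c σ μ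

end QuasiBaricentricData

end EventPOV

end

/-!
The norm of `τ(I)` is at most `1`, so it is enough to find states `ψ` of norm at most `1` for which
the probability `(ψ, τ(B) ψ)` of a ball `B ⊆ I` centred at a given `x₀` is arbitrarily close to `1`.
The states have the wave functions `c_σ(μ) w_m(k) f(k - λ e₀)`, with `e₀` the unit vector of the
time axis, `λ` a large energy and `f` a fixed profile in momentum space.

*Spin.* The elements `a_k` contain arbitrary rotations, since only `Λ(a_k)` applied to a momentum at
rest is prescribed. With `b_k` the lower triangular boost (`coneBoost`), `a_k⁻¹ b_k` is unitary, and
the amplitudes `w_m` are the coefficients in the basis of spin `j` of the transform by this rotation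
of the basis vector of index `0` (`principalAction_rotation`, the binomial formula). As the
principal series is unitary (`principalInner_action_action`, a Moebius change of variable), the sum
over the spin indices collapses to `D₀₀(b_{k'}⁻¹ b_k)` (`sum_repD_rotated`). This is bounded by `1`
(`norm_repD_le_one`), and tends to `1` when `λ → ∞`, because the velocities of `k + λ e₀` and
`k' + λ e₀` become equal (`tendsto_repD_coneBoost`).

*Multiplicity.* For almost all masses, `F` maps square summable `c` to `ℓ²` as a contraction, and
`r̂(μ', μ)` is the scalar product of the images of `c(μ')` and `c(μ)`. Hence `|r̂| ≤ 1`, and `r̂` is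
the limit of the kernels obtained from finitely many values of `σ` (`norm_rHat_cutoff_le`,
`tendsto_rHat_cutoff`). These truncations are needed because the formula for the density is only
available for wave functions with finitely many components. That "almost all masses" becomes
"almost all momenta" is `ae_mass`.

*Limits.* After a translation by `λ e₀` in momentum space, the density of the test state is
`(2π)⁻⁴ ∫∫ exp(i x·(k' - k)) K_λ(k', k) conj(f(k')) f(k)`, with `|K_λ| ≤ 1`. By dominated
convergence (`tendsto_regionIntegral`) the truncation in `σ` can be removed, and then `λ → ∞`
replaces `K_λ` by `1`: the masses tend to infinity and their difference tends to `k⁰ - k'⁰`, so that the hypothesis on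
`r̂` applies. Thus `‖τ(I)‖ ≥ (2π)⁻⁴ ∫_B |∫ exp(-i x·k) f(k) d⁴k|² d⁴x` for every normalized profile
(`setIntegral_fourier_le_norm`). For wide Gaussian profiles with the phase `exp(i x₀·k)` the
right-hand side tends to `1` (`tendsto_setIntegral_fourier_gaussProfile`).
-/

namespace EventPOV

/-! ### Invariance of the scalar product of the principal series -/

/-- The row vector `(ζ, 1) a`. -/
theorem vecMul_affine (a : Matrix (Fin 2) (Fin 2) ℂ) (ζ : ℂ) :
    Matrix.vecMul ![ζ, 1] a = ![ζ * a 0 0 + a 1 0, ζ * a 0 1 + a 1 1] := by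
  ext i
  fin_cases i <;> simp [Matrix.vecMul, dotProduct, Fin.sum_univ_two]

section Moebius

variable {a : Matrix (Fin 2) (Fin 2) ℂ}

theorem hasFDerivAt_moebius (ha : a.det = 1) {ζ : ℂ} (hζ : ζ * a 0 1 + a 1 1 ≠ 0) :
    HasFDerivAt (fun ζ : ℂ => (ζ * a 0 0 + a 1 0) / (ζ * a 0 1 + a 1 1))
      ((ContinuousLinearMap.toSpanSingleton ℂ
        (((ζ * a 0 1 + a 1 1) ^ 2)⁻¹ : ℂ)).restrictScalars ℝ) ζ := by
  apply HasFDerivAt.restrictScalars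
  have h1 : HasDerivAt (fun ζ : ℂ => ζ * a 0 0 + a 1 0) (a 0 0) ζ := by
    simpa using ((hasDerivAt_id ζ).mul_const (a 0 0)).add_const (a 1 0)
  have h2 : HasDerivAt (fun ζ : ℂ => ζ * a 0 1 + a 1 1) (a 0 1) ζ := by
    simpa using ((hasDerivAt_id ζ).mul_const (a 0 1)).add_const (a 1 1)
  have h := (h1.div h2 hζ).hasFDerivAt
  rw [Matrix.det_fin_two] at ha
  have e : (a 0 0 * (ζ * a 0 1 + a 1 1) - (ζ * a 0 0 + a 1 0) * a 0 1) / (ζ * a 0 1 + a 1 1) ^ 2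
      = ((ζ * a 0 1 + a 1 1) ^ 2)⁻¹ := by
    rw [div_eq_mul_inv]
    convert one_mul _ using 2
    linear_combination ha
  rw [e] at h
  exact h

theorem abs_det_moebius (w : ℂ) :
    |((ContinuousLinearMap.toSpanSingleton ℂ ((w ^ 2)⁻¹ : ℂ)).restrictScalars ℝ).det|
      = (‖w‖ ^ 4)⁻¹ := by
  have : ((ContinuousLinearMap.toSpanSingleton ℂ ((w ^ 2)⁻¹ : ℂ)).restrictScalars ℝ).det
      = (‖w‖ ^ 4)⁻¹ := by
    simp [ContinuousLinearMap.det, LinearMap.det_restrictScalars, Algebra.norm_complex_apply,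
      Complex.normSq_eq_norm_sq, ← pow_mul]
  rw [this, abs_of_nonneg (by positivity)]

theorem volume_affine_zero (ha : a.det = 1) :
    volume {ζ : ℂ | ζ * a 0 1 + a 1 1 ≠ 0}ᶜ = 0 := by
  apply Set.Countable.measure_zero
  apply Set.Subsingleton.countable
  intro x hx y hy
  simp only [ne_eq, Set.mem_compl_iff, Set.mem_ofPred_eq, not_not] at hx hy
  by_cases h : a 0 1 = 0
  · rw [Matrix.det_fin_two, h] at ha
    simp [h] at hx
    simp [hx] at ha
  · have : (x - y) * a 0 1 = 0 := by linear_combination hx - hy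
    simpa [h, sub_eq_zero] using this

theorem injOn_moebius (ha : a.det = 1) :
    Set.InjOn (fun ζ : ℂ => (ζ * a 0 0 + a 1 0) / (ζ * a 0 1 + a 1 1))
      {ζ : ℂ | ζ * a 0 1 + a 1 1 ≠ 0} := by
  intro x hx y hy h
  rw [Matrix.det_fin_two] at ha
  simp only [] at h
  rw [div_eq_div_iff hx hy] at h
  linear_combination h - (x - y) * ha

theorem volume_image_moebius_compl (ha : a.det = 1) :
    volume ((fun ζ : ℂ => (ζ * a 0 0 + a 1 0) / (ζ * a 0 1 + a 1 1)) ''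
      {ζ : ℂ | ζ * a 0 1 + a 1 1 ≠ 0})ᶜ = 0 := by
  have hb : (!![a 1 1, -a 0 1; -a 1 0, a 0 0] : Matrix (Fin 2) (Fin 2) ℂ).det = 1 := by
    rw [Matrix.det_fin_two] at ha ⊢
    simp
    linear_combination ha
  refine measure_mono_null ?_ (volume_affine_zero hb)
  rw [Set.compl_subset_compl]
  intro w hw
  simp only [Matrix.of_apply, Matrix.cons_val', Matrix.cons_val_one, Matrix.cons_val_zero,
    Matrix.cons_val_fin_one, ne_eq, Set.mem_ofPred_eq] at hw
  rw [Matrix.det_fin_two] at ha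
  have hw' : w * -a 0 1 + a 0 0 ≠ 0 := hw
  have h3 : (w * a 1 1 - a 1 0) / (w * -a 0 1 + a 0 0) * a 0 1 + a 1 1
      = 1 / (w * -a 0 1 + a 0 0) := by
    rw [div_mul_eq_mul_div, div_add' _ _ _ hw']
    congr 1
    linear_combination ha
  refine ⟨(w * a 1 1 - a 1 0) / (w * -a 0 1 + a 0 0), ?_, ?_⟩
  · simp only [Set.mem_ofPred_eq, h3]
    exact one_div_ne_zero hw
  · simp only [h3]
    rw [div_mul_eq_mul_div, div_add' _ _ _ hw', div_div_div_cancel_right₀ hw', div_one]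
    linear_combination w * ha

variable {E : Type*} [NormedAddCommGroup E] [NormedSpace ℝ E]

/-- The functions on `ℂ²` which are homogeneous of degree `-4` (and depend only on the modulus of
the scale factor) have an `SL(2, ℂ)`-invariant integral: `(ζ, 1) a` is the multiple of
`(φ(ζ), 1)`, with `φ` the Moebius transformation defined by `a`, and the Jacobian of `φ` is the
power of the scale factor given by the homogeneity. -/
theorem integral_affine_vecMul (ha : a.det = 1) {f : (Fin 2 → ℂ) → E}
    (hf : ∀ t : ℂ, t ≠ 0 → ∀ z, f (t • z) = (‖t‖ ^ 4)⁻¹ • f z) :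
    ∫ ζ : ℂ, f (Matrix.vecMul ![ζ, 1] a) = ∫ ζ : ℂ, f ![ζ, 1] := by
  set s := {ζ : ℂ | ζ * a 0 1 + a 1 1 ≠ 0} with hs
  have hsm : MeasurableSet s := by
    refine (isOpen_ne_fun ?_ ?_).measurableSet <;> fun_prop
  have h := integral_image_eq_integral_abs_det_fderiv_smul volume hsm
    (fun ζ hζ => (hasFDerivAt_moebius ha hζ).hasFDerivWithinAt) (injOn_moebius ha)
    (fun ζ => f ![ζ, 1])
  rw [setIntegral_congr_set (ae_eq_univ.2 (volume_image_moebius_compl ha)), setIntegral_univ] at h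
  rw [h, ← setIntegral_univ, ← setIntegral_congr_set (ae_eq_univ.2 (volume_affine_zero ha))]
  refine setIntegral_congr_fun hsm fun ζ hζ => ?_
  simp only [abs_det_moebius]
  rw [← hf _ hζ, vecMul_affine]
  congr 1
  ext i
  fin_cases i
  · simpa using (mul_div_cancel₀ _ hζ).symm
  · simp

end Moebius

/-! ### The vectors of lowest spin -/

theorem principalVector_smul (J : ℕ) (m : Fin (J + 1)) (t : ℂ) (z : Fin 2 → ℂ) :
    principalVector J m (t • z) = t ^ J / (‖t‖ : ℂ) ^ (J + 2) * principalVector J m z := by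
  have h : Real.sqrt (‖(t • z) 0‖ ^ 2 + ‖(t • z) 1‖ ^ 2)
      = ‖t‖ * Real.sqrt (‖z 0‖ ^ 2 + ‖z 1‖ ^ 2) := by
    simp only [Pi.smul_apply, smul_eq_mul, norm_mul]
    rw [← Real.sqrt_sq (norm_nonneg t), ← Real.sqrt_mul (by positivity),
      Real.sqrt_sq (norm_nonneg t)]
    ring_nf
  have hm : t ^ J = t ^ (m : ℕ) * t ^ (J - (m : ℕ)) := by
    rw [← pow_add]; congr 1; omega
  unfold principalVector
  rw [h, hm]
  simp only [Pi.smul_apply, smul_eq_mul, mul_pow]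
  push_cast
  rw [div_mul_div_comm]
  ring

/-- `conj (f z) g(z)` is homogeneous of degree `-4` if `f`, `g` are combinations of the basis
vectors and of their transforms. -/
theorem conj_mul_homogeneous {J : ℕ} {f g : (Fin 2 → ℂ) → ℂ}
    (hf : ∀ t z, f (t • z) = t ^ J / (‖t‖ : ℂ) ^ (J + 2) * f z)
    (hg : ∀ t z, g (t • z) = t ^ J / (‖t‖ : ℂ) ^ (J + 2) * g z)
    (t : ℂ) (ht : t ≠ 0) (z : Fin 2 → ℂ) :
    conj (f (t • z)) * g (t • z) = (‖t‖ ^ 4)⁻¹ • (conj (f z) * g z) := by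
  have h : conj (t ^ J / (‖t‖ : ℂ) ^ (J + 2)) * (t ^ J / (‖t‖ : ℂ) ^ (J + 2))
      = ((‖t‖ ^ 4)⁻¹ : ℝ) := by
    have ht' : (‖t‖ : ℂ) ≠ 0 := by simpa using ht
    rw [Complex.conj_mul', norm_div, norm_pow, norm_pow]
    simp only [Complex.norm_real, norm_norm]
    push_cast
    field_simp
    ring
  rw [hf, hg, map_mul, Complex.real_smul, ← h]
  ring

theorem principalAction_homogeneous {J : ℕ} {f : (Fin 2 → ℂ) → ℂ}
    (hf : ∀ t z, f (t • z) = t ^ J / (‖t‖ : ℂ) ^ (J + 2) * f z)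
    (a : Matrix.SpecialLinearGroup (Fin 2) ℂ) (t : ℂ) (z : Fin 2 → ℂ) :
    principalAction a f (t • z) = t ^ J / (‖t‖ : ℂ) ^ (J + 2) * principalAction a f z := by
  simp only [principalAction, Matrix.smul_vecMul, hf]

/-- The principal series is unitary. -/
theorem principalInner_action_action {J : ℕ} {f g : (Fin 2 → ℂ) → ℂ}
    (hf : ∀ t z, f (t • z) = t ^ J / (‖t‖ : ℂ) ^ (J + 2) * f z)
    (hg : ∀ t z, g (t • z) = t ^ J / (‖t‖ : ℂ) ^ (J + 2) * g z)
    (a : Matrix.SpecialLinearGroup (Fin 2) ℂ) :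
    principalInner (principalAction a f) (principalAction a g) = principalInner f g := by
  unfold principalInner principalAction
  rw [integral_affine_vecMul (a := (a : Matrix (Fin 2) (Fin 2) ℂ)) a.2
    (f := fun z => conj (f z) * g z) (conj_mul_homogeneous hf hg)]

theorem principalAction_mul (a b : Matrix.SpecialLinearGroup (Fin 2) ℂ) (f : (Fin 2 → ℂ) → ℂ) :
    principalAction (a * b) f = principalAction a (principalAction b f) := by
  ext z
  simp [principalAction, Matrix.vecMul_vecMul]

/-- The basis vectors are bounded by a multiple of `|z|⁻²`. -/
theorem exists_norm_principalVector_le (J : ℕ) (m : Fin (J + 1)) :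
    ∃ C : ℝ, 0 ≤ C ∧ ∀ z, ‖principalVector J m z‖ ≤ C / (‖z 0‖ ^ 2 + ‖z 1‖ ^ 2) := by
  refine ⟨Real.sqrt ((J + 1).factorial / ((m : ℕ).factorial * (J - (m : ℕ)).factorial)),
    Real.sqrt_nonneg _, fun z => ?_⟩
  set q := ‖z 0‖ ^ 2 + ‖z 1‖ ^ 2 with hq
  have hq0 : 0 ≤ q := by positivity
  have h0 : ‖z 0‖ ≤ Real.sqrt q := Real.le_sqrt_of_sq_le (by rw [hq]; nlinarith [sq_nonneg ‖z 1‖])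
  have h1 : ‖z 1‖ ≤ Real.sqrt q := Real.le_sqrt_of_sq_le (by rw [hq]; nlinarith [sq_nonneg ‖z 0‖])
  have hm : Real.sqrt q ^ J = Real.sqrt q ^ (m : ℕ) * Real.sqrt q ^ (J - (m : ℕ)) := by
    rw [← pow_add]; congr 1; omega
  unfold principalVector
  rw [norm_div, norm_mul, norm_mul, norm_pow, norm_pow, Complex.norm_real, Complex.norm_real,
    Real.norm_of_nonneg (Real.sqrt_nonneg _), ← hq,
    Real.norm_of_nonneg (pow_nonneg (Real.sqrt_nonneg _) _)]
  rcases hq0.eq_or_lt with h | h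
  · simp [← h]
  · rw [div_le_div_iff₀ (by positivity) h, pow_add _ J 2, Real.sq_sqrt hq0, hm]
    set A := Real.sqrt ((J + 1).factorial / ((m : ℕ).factorial * (J - (m : ℕ)).factorial))
    calc A * ‖z 0‖ ^ (m : ℕ) * ‖z 1‖ ^ (J - (m : ℕ)) * q
        ≤ A * Real.sqrt q ^ (m : ℕ) * Real.sqrt q ^ (J - (m : ℕ)) * q := by gcongr
      _ = _ := by ring

theorem measurable_principalVector (J : ℕ) (m : Fin (J + 1)) :
    Measurable (principalVector J m) := by
  unfold principalVector
  fun_prop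

theorem integrable_affine_decay : Integrable fun ζ : ℂ => ((‖ζ‖ ^ 2 + 1) ^ 2)⁻¹ := by
  have h := integrable_rpow_neg_one_add_norm_sq (E := ℂ) (μ := volume) (r := 4)
    (by rw [Complex.finrank_real_complex]; norm_num)
  refine h.congr (ae_of_all _ fun ζ => ?_)
  have : (0 : ℝ) ≤ 1 + ‖ζ‖ ^ 2 := by positivity
  simp only
  rw [show (-4 / 2 : ℝ) = -(2 : ℕ) by norm_num, Real.rpow_neg this, Real.rpow_natCast, add_comm]

/-- For `det a = 1` the vector `z a` is not much shorter than `z`. -/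
theorem norm_sq_le_vecMul {a : Matrix (Fin 2) (Fin 2) ℂ} (ha : a.det = 1) (z : Fin 2 → ℂ) :
    ‖z 0‖ ^ 2 + ‖z 1‖ ^ 2 ≤
      (‖a 0 0‖ ^ 2 + ‖a 0 1‖ ^ 2 + ‖a 1 0‖ ^ 2 + ‖a 1 1‖ ^ 2) *
        (‖Matrix.vecMul z a 0‖ ^ 2 + ‖Matrix.vecMul z a 1‖ ^ 2) := by
  have key : ∀ p q r s : ℂ, ‖p * q + r * s‖ ^ 2 ≤
      (‖p‖ ^ 2 + ‖r‖ ^ 2) * (‖q‖ ^ 2 + ‖s‖ ^ 2) := by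
    intro p q r s
    have h : ‖p * q + r * s‖ ≤ ‖p‖ * ‖q‖ + ‖r‖ * ‖s‖ := by
      simpa only [norm_mul] using norm_add_le (p * q) (r * s)
    calc _ ≤ (‖p‖ * ‖q‖ + ‖r‖ * ‖s‖) ^ 2 := by gcongr
      _ ≤ _ := by nlinarith [sq_nonneg (‖p‖ * ‖s‖ - ‖r‖ * ‖q‖)]
  rw [Matrix.det_fin_two] at ha
  have e0 : z 0 = a 1 1 * Matrix.vecMul z a 0 + -a 1 0 * Matrix.vecMul z a 1 := by
    simp only [Matrix.vecMul, dotProduct, Fin.sum_univ_two]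
    linear_combination -(z 0) * ha
  have e1 : z 1 = -a 0 1 * Matrix.vecMul z a 0 + a 0 0 * Matrix.vecMul z a 1 := by
    simp only [Matrix.vecMul, dotProduct, Fin.sum_univ_two]
    linear_combination -(z 1) * ha
  have h0 := key (a 1 1) (Matrix.vecMul z a 0) (-a 1 0) (Matrix.vecMul z a 1)
  have h1 := key (-a 0 1) (Matrix.vecMul z a 0) (a 0 0) (Matrix.vecMul z a 1)
  rw [← e0, norm_neg] at h0
  rw [← e1, norm_neg] at h1
  nlinarith

/-- A bound for the integrand of the matrix elements, locally uniform in the group element. -/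
theorem norm_conj_mul_action_le {J : ℕ} (m' m : Fin (J + 1)) :
    ∃ C : ℝ, 0 ≤ C ∧ ∀ (a : Matrix.SpecialLinearGroup (Fin 2) ℂ) (ζ : ℂ),
      ‖conj (principalVector J m' ![ζ, 1]) *
        principalAction a (principalVector J m) ![ζ, 1]‖ ≤
      C * (‖a 0 0‖ ^ 2 + ‖a 0 1‖ ^ 2 + ‖a 1 0‖ ^ 2 + ‖a 1 1‖ ^ 2) *
        ((‖ζ‖ ^ 2 + 1) ^ 2)⁻¹ := by
  obtain ⟨C', hC', h'⟩ := exists_norm_principalVector_le J m'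
  obtain ⟨C, hC, h⟩ := exists_norm_principalVector_le J m
  refine ⟨C' * C, by positivity, fun a ζ => ?_⟩
  have h1 := h' ![ζ, 1]
  have h2 := h (Matrix.vecMul ![ζ, 1] (a : Matrix (Fin 2) (Fin 2) ℂ))
  have h3 := norm_sq_le_vecMul (a := (a : Matrix (Fin 2) (Fin 2) ℂ)) a.2 ![ζ, 1]
  simp only [Matrix.cons_val_zero, Matrix.cons_val_one, norm_one, one_pow] at h1 h3
  set v := Matrix.vecMul ![ζ, 1] (a : Matrix (Fin 2) (Fin 2) ℂ)
  set n := (‖a 0 0‖ ^ 2 + ‖a 0 1‖ ^ 2 + ‖a 1 0‖ ^ 2 + ‖a 1 1‖ ^ 2)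
  have hn : 0 ≤ n := by positivity
  have hq : 0 < ‖ζ‖ ^ 2 + 1 := by positivity
  have hv : 0 < ‖v 0‖ ^ 2 + ‖v 1‖ ^ 2 := by
    by_contra hcon
    have : ‖v 0‖ ^ 2 + ‖v 1‖ ^ 2 = 0 := le_antisymm (not_lt.1 hcon) (by positivity)
    rw [this, mul_zero] at h3
    linarith
  rw [norm_mul, RCLike.norm_conj]
  calc ‖principalVector J m' ![ζ, 1]‖ * ‖principalAction a (principalVector J m) ![ζ, 1]‖
      ≤ (C' / (‖ζ‖ ^ 2 + 1)) * (C / (‖v 0‖ ^ 2 + ‖v 1‖ ^ 2)) := by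
        gcongr
        exact h2
    _ ≤ (C' / (‖ζ‖ ^ 2 + 1)) * (C * n / (‖ζ‖ ^ 2 + 1)) := by
        gcongr ?_ * ?_
        rw [div_le_div_iff₀ hv hq]
        calc C * (‖ζ‖ ^ 2 + 1) ≤ C * (n * (‖v 0‖ ^ 2 + ‖v 1‖ ^ 2)) := by gcongr
          _ = C * n * (‖v 0‖ ^ 2 + ‖v 1‖ ^ 2) := by ring
    _ = _ := by field_simp

theorem measurable_affine : Measurable fun ζ : ℂ => (![ζ, 1] : Fin 2 → ℂ) := by
  rw [measurable_pi_iff]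
  intro i
  fin_cases i
  · exact measurable_id
  · exact measurable_const

theorem measurable_vecMul_affine {Ω : Type*} [MeasurableSpace Ω]
    {g : Ω → Matrix (Fin 2) (Fin 2) ℂ} (hg : ∀ i i', Measurable fun ω => g ω i i') :
    Measurable fun p : Ω × ℂ => Matrix.vecMul ![p.2, 1] (g p.1) := by
  rw [measurable_pi_iff]
  have h : ∀ i i', Measurable fun p : Ω × ℂ => g p.1 i i' := fun i i' =>
    (hg i i').comp measurable_fst
  intro i
  simp only [vecMul_affine]
  fin_cases i
  · exact (measurable_snd.mul (h 0 0)).add (h 1 0)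
  · exact (measurable_snd.mul (h 0 1)).add (h 1 1)

theorem integrable_conj_mul_action {J : ℕ} (m' m : Fin (J + 1))
    (a : Matrix.SpecialLinearGroup (Fin 2) ℂ) :
    Integrable fun ζ : ℂ => conj (principalVector J m' ![ζ, 1]) *
      principalAction a (principalVector J m) ![ζ, 1] := by
  obtain ⟨C, -, h⟩ := norm_conj_mul_action_le m' m
  refine (integrable_affine_decay.const_mul _).mono' ?_ (ae_of_all _ (h a))
  have h1 : Measurable fun ζ : ℂ => principalVector J m' ![ζ, 1] :=
    (measurable_principalVector J m').comp measurable_affine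
  have h2 : Measurable fun ζ : ℂ => Matrix.vecMul ![ζ, 1] (a : Matrix (Fin 2) (Fin 2) ℂ) :=
    (measurable_vecMul_affine (Ω := Unit) (g := fun _ => a) (fun _ _ => measurable_const)).comp
      (measurable_const.prodMk measurable_id : Measurable fun ζ : ℂ => ((), ζ))
  exact ((Complex.continuous_conj.measurable.comp h1).mul
    ((measurable_principalVector J m).comp h2)).aestronglyMeasurable

/-! ### Diagonal matrix elements -/

theorem norm_principalVector_zero_affine_sq (J : ℕ) (ζ : ℂ) :
    ‖principalVector J 0 ![ζ, 1]‖ ^ 2 = (J + 1) * ((‖ζ‖ ^ 2 + 1) ^ (J + 2))⁻¹ := by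
  have hq : 0 ≤ ‖ζ‖ ^ 2 + 1 := by positivity
  have hJ : ((J + 1).factorial / J.factorial : ℝ) = J + 1 := by
    rw [Nat.factorial_succ]
    push_cast
    exact mul_div_cancel_right₀ _ (by positivity)
  simp only [principalVector, Matrix.cons_val_zero, Matrix.cons_val_one, norm_one, one_pow,
    Fin.val_zero, pow_zero, Nat.factorial_zero, Nat.cast_one, one_mul, Nat.sub_zero, mul_one]
  rw [hJ, norm_div, Complex.norm_real, Complex.norm_real, div_pow,
    Real.norm_of_nonneg (Real.sqrt_nonneg _), Real.sq_sqrt (by positivity),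
    Real.norm_of_nonneg (pow_nonneg (Real.sqrt_nonneg _) _), ← pow_mul, mul_comm (J + 2) 2,
    pow_mul, Real.sq_sqrt hq, div_eq_mul_inv]

/-- The basis vector of index `0` is normalized; the radial integral has an elementary primitive. -/
theorem integral_norm_principalVector_zero (J : ℕ) :
    ∫ ζ : ℂ, ‖principalVector J 0 ![ζ, 1]‖ ^ 2 = Real.pi := by
  simp only [norm_principalVector_zero_affine_sq]
  rw [integral_fun_norm_addHaar volume fun y : ℝ => (J + 1 : ℝ) * ((y ^ 2 + 1) ^ (J + 2))⁻¹]
  have hd : ∀ x ∈ Set.Ici (0 : ℝ), HasDerivAt (fun y : ℝ => -(1 / 2) * ((y ^ 2 + 1) ^ (J + 1))⁻¹)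
      (x ^ (Module.finrank ℝ ℂ - 1) • ((J + 1 : ℝ) * ((x ^ 2 + 1) ^ (J + 2))⁻¹)) x := by
    intro x _
    have hx : x ^ 2 + 1 ≠ 0 := by positivity
    have h1 : HasDerivAt (fun y : ℝ => y ^ 2 + 1) (2 * x) x := by
      simpa using (hasDerivAt_pow 2 x).add_const 1
    have h2 := (((h1.pow (J + 1)).inv (pow_ne_zero _ hx)).const_mul (-(1 / 2)))
    have e : x ^ (Module.finrank ℝ ℂ - 1) • ((J + 1 : ℝ) * ((x ^ 2 + 1) ^ (J + 2))⁻¹) =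
        -(1 / 2) * (-((J + 1 : ℕ) * (x ^ 2 + 1) ^ J * (2 * x)) / ((x ^ 2 + 1) ^ (J + 1)) ^ 2) := by
      rw [Complex.finrank_real_complex]
      simp only [Nat.add_one_sub_one, smul_eq_mul, pow_one]
      push_cast
      field_simp
      ring
    rw [e]
    exact h2
  have ht : Tendsto (fun y : ℝ => -(1 / 2) * ((y ^ 2 + 1) ^ (J + 1))⁻¹) atTop
      (𝓝 (-(1 / 2) * 0)) := by
    refine Tendsto.const_mul _ (tendsto_inv_atTop_zero.comp ?_)
    refine (tendsto_pow_atTop (Nat.succ_ne_zero J)).comp ?_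
    exact tendsto_atTop_add_const_right _ _ (tendsto_pow_atTop two_ne_zero)
  rw [integral_Ioi_of_hasDerivAt_of_nonneg' hd ?_ ht]
  · rw [Measure.real, Complex.volume_ball, Complex.finrank_real_complex]
    simp
    ring
  · intro x hx
    have : (0 : ℝ) < x := hx
    positivity

theorem repD_zero_zero {J : ℕ} (hJ : J ≠ 0) (a : Matrix.SpecialLinearGroup (Fin 2) ℂ) :
    repD J a 0 0 =
      principalInner (principalVector J 0) (principalAction a (principalVector J 0)) := by
  simp [repD, hJ]

/-- The matrix elements on the diagonal are bounded by `1`, as the representation is unitary. -/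
theorem norm_repD_le_one (J : ℕ) (a : Matrix.SpecialLinearGroup (Fin 2) ℂ) :
    ‖repD J a 0 0‖ ≤ 1 := by
  by_cases hJ : J = 0
  · simp [repD, hJ]
  rw [repD_zero_zero hJ, principalInner, norm_mul, norm_inv, Complex.norm_real,
    Real.norm_of_nonneg Real.pi_pos.le, inv_mul_le_one₀ Real.pi_pos]
  have h0 := integral_norm_principalVector_zero J
  have h1 : ∫ ζ : ℂ, ‖principalAction a (principalVector J 0) ![ζ, 1]‖ ^ 2 = Real.pi := by
    rw [← h0]
    refine integral_affine_vecMul (a := (a : Matrix (Fin 2) (Fin 2) ℂ)) a.2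
      (f := fun z => ‖principalVector J 0 z‖ ^ 2) fun t ht z => ?_
    have ht' : ‖t‖ ≠ 0 := by simpa using ht
    simp only [principalVector_smul, norm_mul, norm_div, norm_pow, Complex.norm_real, norm_norm,
      smul_eq_mul]
    field_simp
    ring
  -- The integrals do not vanish, hence the functions are integrable.
  have i0 : Integrable fun ζ : ℂ => ‖principalVector J 0 ![ζ, 1]‖ ^ 2 :=
    not_imp_comm.1 integral_undef (by rw [h0]; exact Real.pi_ne_zero)
  have i1 : Integrable fun ζ : ℂ => ‖principalAction a (principalVector J 0) ![ζ, 1]‖ ^ 2 :=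
    not_imp_comm.1 integral_undef (by rw [h1]; exact Real.pi_ne_zero)
  calc _ ≤ ∫ ζ : ℂ, (‖principalVector J 0 ![ζ, 1]‖ ^ 2 +
          ‖principalAction a (principalVector J 0) ![ζ, 1]‖ ^ 2) / 2 := by
        refine norm_integral_le_of_norm_le ((i0.add i1).div_const 2) (ae_of_all _ fun ζ => ?_)
        rw [norm_mul, RCLike.norm_conj]
        nlinarith [sq_nonneg (‖principalVector J 0 ![ζ, 1]‖ -
          ‖principalAction a (principalVector J 0) ![ζ, 1]‖)]
    _ = Real.pi := by
        rw [integral_div, integral_add i0 i1, h0, h1]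
        ring

/-- The diagonal matrix element is continuous at the unit of the group. -/
theorem tendsto_repD {ι : Type*} {l : Filter ι} [l.IsCountablyGenerated] (J : ℕ)
    {g : ι → Matrix.SpecialLinearGroup (Fin 2) ℂ}
    (hg : ∀ i i', Tendsto (fun n => g n i i') l (𝓝 ((1 : Matrix (Fin 2) (Fin 2) ℂ) i i'))) :
    Tendsto (fun n => repD J (g n) 0 0) l (𝓝 1) := by
  by_cases hJ : J = 0
  · simp [repD, hJ, tendsto_const_nhds]
  have hone : principalInner (principalVector J 0) (principalVector J 0) = 1 := by
    simp only [principalInner, Complex.conj_mul']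
    have h := congrArg (fun r : ℝ => (r : ℂ)) (integral_norm_principalVector_zero J)
    simp only [← integral_complex_ofReal, Complex.ofReal_pow] at h
    rw [h]
    exact inv_mul_cancel₀ (by exact_mod_cast Real.pi_ne_zero)
  simp only [repD_zero_zero hJ]
  rw [← hone]
  unfold principalInner
  refine Tendsto.const_mul _ ?_
  obtain ⟨C, hC, h⟩ := norm_conj_mul_action_le (J := J) 0 0
  have hn : Tendsto (fun n => ‖g n 0 0‖ ^ 2 + ‖g n 0 1‖ ^ 2 + ‖g n 1 0‖ ^ 2 + ‖g n 1 1‖ ^ 2) l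
      (𝓝 (‖(1 : Matrix (Fin 2) (Fin 2) ℂ) 0 0‖ ^ 2 + ‖(1 : Matrix (Fin 2) (Fin 2) ℂ) 0 1‖ ^ 2 +
        ‖(1 : Matrix (Fin 2) (Fin 2) ℂ) 1 0‖ ^ 2 + ‖(1 : Matrix (Fin 2) (Fin 2) ℂ) 1 1‖ ^ 2)) :=
    ((((hg 0 0).norm.pow 2).add ((hg 0 1).norm.pow 2)).add ((hg 1 0).norm.pow 2)).add
      ((hg 1 1).norm.pow 2)
  refine tendsto_integral_filter_of_dominated_convergence
    (fun ζ : ℂ => C * 3 * ((‖ζ‖ ^ 2 + 1) ^ 2)⁻¹)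
    (Eventually.of_forall fun n => (integrable_conj_mul_action 0 0 (g n)).aestronglyMeasurable) ?_
    (integrable_affine_decay.const_mul _) (ae_of_all _ fun ζ => ?_)
  · filter_upwards [hn.eventually_lt_const (u := 3) (by norm_num [Matrix.one_apply])] with n hn
    refine ae_of_all _ fun ζ => (h (g n) ζ).trans ?_
    gcongr
  · refine Tendsto.const_mul _ ?_
    have hcont : ContinuousAt (principalVector J 0) ![ζ, 1] := by
      unfold principalVector
      refine ContinuousAt.div (by fun_prop) (by fun_prop) ?_
      have : (0 : ℝ) < ‖ζ‖ ^ 2 + 1 := by positivity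
      simp only [Matrix.cons_val_zero, Matrix.cons_val_one, norm_one, one_pow]
      exact_mod_cast (pow_pos (Real.sqrt_pos.2 this) _).ne'
    refine hcont.tendsto.comp (tendsto_pi_nhds.2 fun i => ?_)
    simp only [vecMul_affine]
    fin_cases i
    · simpa using ((hg 0 0).const_mul ζ).add (hg 1 0)
    · simpa using ((hg 0 1).const_mul ζ).add (hg 1 1)

theorem measurable_repD {Ω : Type*} [MeasurableSpace Ω] (J : ℕ)
    {g : Ω → Matrix.SpecialLinearGroup (Fin 2) ℂ} (hg : ∀ i i', Measurable fun ω => g ω i i') :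
    Measurable fun ω => repD J (g ω) 0 0 := by
  by_cases hJ : J = 0
  · simp [repD, hJ]
  simp only [repD_zero_zero hJ]
  refine Measurable.const_mul (StronglyMeasurable.measurable ?_) _
  refine StronglyMeasurable.integral_prod_right (f := fun ω (ζ : ℂ) =>
    conj (principalVector J 0 ![ζ, 1]) * principalAction (g ω) (principalVector J 0) ![ζ, 1])
    (Measurable.stronglyMeasurable ?_)
  refine Measurable.mul ?_ ?_
  · exact Complex.continuous_conj.measurable.comp
      ((measurable_principalVector J 0).comp (measurable_affine.comp measurable_snd))
  · exact (measurable_principalVector J 0).comp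
      (measurable_vecMul_affine (g := fun ω => (g ω : Matrix (Fin 2) (Fin 2) ℂ)) hg)

/-! ### Rotation of the lowest basis vector -/

/-- The components `(J choose m)^{1/2} p^m q^{J-m}` of the vector obtained by applying to the basis
vector of index `0` a rotation with second column `(p, q)`. -/
noncomputable def rotated (J : ℕ) (m : Fin (J + 1)) (p q : ℂ) : ℂ :=
  (Real.sqrt (J.choose m) : ℂ) * p ^ (m : ℕ) * q ^ (J - (m : ℕ))

theorem sum_norm_rotated (J : ℕ) {p q : ℂ} (h : ‖p‖ ^ 2 + ‖q‖ ^ 2 = 1) :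
    ∑ m : Fin (J + 1), ‖rotated J m p q‖ ^ 2 = 1 := by
  have h' : (‖p‖ ^ 2 + ‖q‖ ^ 2) ^ J = 1 := by rw [h, one_pow]
  rw [← h', add_pow, Finset.sum_range]
  refine Finset.sum_congr rfl fun m _ => ?_
  rw [rotated, norm_mul, norm_mul, norm_pow, norm_pow, Complex.norm_real,
    Real.norm_of_nonneg (Real.sqrt_nonneg _), mul_pow, mul_pow, Real.sq_sqrt (by positivity)]
  ring

/-- Unitary matrices preserve the length, here for their action on row vectors. -/
theorem norm_sq_vecMul_of_unitary {v : Matrix (Fin 2) (Fin 2) ℂ} (hv : v * v.conjTranspose = 1)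
    (z : Fin 2 → ℂ) :
    ‖Matrix.vecMul z v 0‖ ^ 2 + ‖Matrix.vecMul z v 1‖ ^ 2 = ‖z 0‖ ^ 2 + ‖z 1‖ ^ 2 := by
  have h : ∀ i i', (v * v.conjTranspose) i i' = (1 : Matrix (Fin 2) (Fin 2) ℂ) i i' := by
    simp [hv]
  have h00 := h 0 0
  have h01 := h 0 1
  have h10 := h 1 0
  have h11 := h 1 1
  simp [Matrix.mul_apply, Fin.sum_univ_two] at h00 h01 h10 h11
  have key : (((‖Matrix.vecMul z v 0‖ ^ 2 + ‖Matrix.vecMul z v 1‖ ^ 2 : ℝ)) : ℂ)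
      = ((‖z 0‖ ^ 2 + ‖z 1‖ ^ 2 : ℝ) : ℂ) := by
    push_cast
    rw [← Complex.mul_conj', ← Complex.mul_conj', ← Complex.mul_conj', ← Complex.mul_conj']
    simp only [Matrix.vecMul, dotProduct, Fin.sum_univ_two, map_add, map_mul]
    linear_combination z 0 * conj (z 0) * h00 + z 0 * conj (z 1) * h01 +
      z 1 * conj (z 0) * h10 + z 1 * conj (z 1) * h11
  exact_mod_cast key

/-- A rotation acts on the basis vector of index `0` by the binomial formula. -/
theorem principalAction_rotation {J : ℕ} {v : Matrix.SpecialLinearGroup (Fin 2) ℂ}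
    (hv : (v : Matrix (Fin 2) (Fin 2) ℂ) * (v : Matrix (Fin 2) (Fin 2) ℂ).conjTranspose = 1)
    (z : Fin 2 → ℂ) :
    principalAction v (principalVector J 0) z =
      ∑ m, rotated J m (v 0 1) (v 1 1) * principalVector J m z := by
  have hz := norm_sq_vecMul_of_unitary hv z
  have h1 : Matrix.vecMul z (v : Matrix (Fin 2) (Fin 2) ℂ) 1 = z 0 * v 0 1 + z 1 * v 1 1 := by
    simp [Matrix.vecMul, dotProduct, Fin.sum_univ_two]
  rw [principalAction, principalVector, hz, h1]
  simp only [principalVector, Fin.val_zero, pow_zero, mul_one,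
    Nat.sub_zero, Nat.factorial_zero, Nat.cast_one, one_mul]
  rw [add_pow, Finset.sum_range, Finset.mul_sum, Finset.sum_div]
  refine Finset.sum_congr rfl fun m _ => ?_
  have hm : (m : ℕ) ≤ J := by omega
  have hc : Real.sqrt ((J + 1).factorial / J.factorial) * (J.choose m : ℝ) =
      Real.sqrt (J.choose m) *
        Real.sqrt ((J + 1).factorial / ((m : ℕ).factorial * (J - (m : ℕ)).factorial)) := by
    have hch : (J.choose m : ℝ) = J.factorial / ((m : ℕ).factorial * (J - (m : ℕ)).factorial) := by
      rw [Nat.cast_choose ℝ hm]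
    have : ((J + 1).factorial / ((m : ℕ).factorial * (J - (m : ℕ)).factorial) : ℝ) =
        (J + 1).factorial / J.factorial * J.choose m := by
      rw [hch]; field_simp
    rw [this, Real.sqrt_mul (by positivity), mul_left_comm, Real.mul_self_sqrt (by positivity)]
  have hc' : (Real.sqrt ((J + 1).factorial / J.factorial) : ℂ) * (J.choose m : ℂ) =
      Real.sqrt (J.choose m) *
        Real.sqrt ((J + 1).factorial / ((m : ℕ).factorial * (J - (m : ℕ)).factorial)) := by
    exact_mod_cast hc
  rw [rotated, ← mul_div_assoc]
  congr 1
  rw [mul_pow, mul_pow]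
  linear_combination (z 0 ^ (m : ℕ) * v 0 1 ^ (m : ℕ) * (z 1 ^ (J - (m : ℕ)) *
    v 1 1 ^ (J - (m : ℕ)))) * hc'

/-- The amplitudes `rotated` remove from the matrix elements the arbitrary rotations contained in
the elements `a` and `a'`, replacing these elements by `b` and `b'`. -/
theorem sum_repD_rotated (J : ℕ) {a a' b b' : Matrix.SpecialLinearGroup (Fin 2) ℂ}
    (hv : ((a⁻¹ * b : Matrix.SpecialLinearGroup (Fin 2) ℂ) : Matrix (Fin 2) (Fin 2) ℂ) *
      ((a⁻¹ * b : Matrix.SpecialLinearGroup (Fin 2) ℂ) :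
        Matrix (Fin 2) (Fin 2) ℂ).conjTranspose = 1)
    (hv' : ((a'⁻¹ * b' : Matrix.SpecialLinearGroup (Fin 2) ℂ) : Matrix (Fin 2) (Fin 2) ℂ) *
      ((a'⁻¹ * b' : Matrix.SpecialLinearGroup (Fin 2) ℂ) :
        Matrix (Fin 2) (Fin 2) ℂ).conjTranspose = 1) :
    ∑ m', ∑ m, repD J (a'⁻¹ * a) m' m *
      conj (rotated J m' ((a'⁻¹ * b') 0 1) ((a'⁻¹ * b') 1 1)) *
        rotated J m ((a⁻¹ * b) 0 1) ((a⁻¹ * b) 1 1) = repD J (b'⁻¹ * b) 0 0 := by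
  by_cases hJ : J = 0
  · subst hJ
    simp [repD, rotated]
  set v := a⁻¹ * b with hvdef
  set v' := a'⁻¹ * b' with hvdef'
  have hg : v' * (b'⁻¹ * b) = (a'⁻¹ * a) * v := by rw [hvdef, hvdef']; group
  rw [repD_zero_zero hJ, ← principalInner_action_action (principalVector_smul J 0)
    (principalAction_homogeneous (principalVector_smul J 0) _) v',
    ← principalAction_mul v' (b'⁻¹ * b), hg, principalAction_mul (a'⁻¹ * a) v]
  have h2 : principalAction v (principalVector J 0) = fun z =>
      ∑ m, rotated J m (v 0 1) (v 1 1) * principalVector J m z :=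
    funext fun z => principalAction_rotation hv z
  have h2' : principalAction v' (principalVector J 0) = fun z =>
      ∑ m, rotated J m (v' 0 1) (v' 1 1) * principalVector J m z :=
    funext fun z => principalAction_rotation hv' z
  rw [h2, h2']
  have hint : ∀ m' m : Fin (J + 1), Integrable fun ζ : ℂ =>
      conj (rotated J m' (v' 0 1) (v' 1 1)) * rotated J m (v 0 1) (v 1 1) *
        (conj (principalVector J m' ![ζ, 1]) *
          principalAction (a'⁻¹ * a) (principalVector J m) ![ζ, 1]) := fun m' m =>
    (integrable_conj_mul_action m' m _).const_mul _
  have hsum : ∀ ζ : ℂ, conj (∑ m, rotated J m (v' 0 1) (v' 1 1) * principalVector J m ![ζ, 1]) *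
      principalAction (a'⁻¹ * a)
        (fun z => ∑ m, rotated J m (v 0 1) (v 1 1) * principalVector J m z) ![ζ, 1] =
      ∑ m', ∑ m, conj (rotated J m' (v' 0 1) (v' 1 1)) * rotated J m (v 0 1) (v 1 1) *
        (conj (principalVector J m' ![ζ, 1]) *
          principalAction (a'⁻¹ * a) (principalVector J m) ![ζ, 1]) := by
    intro ζ
    simp only [principalAction, map_sum, map_mul, Finset.sum_mul_sum]
    refine Finset.sum_congr rfl fun m' _ => Finset.sum_congr rfl fun m _ => ?_
    ring
  simp only [repD, hJ, if_false, principalInner, hsum]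
  rw [integral_finsetSum _ fun m' _ => integrable_finsetSum _ fun m _ => hint m' m,
    Finset.mul_sum]
  refine Finset.sum_congr rfl fun m' _ => ?_
  rw [integral_finsetSum _ fun m _ => hint m' m, Finset.mul_sum]
  refine Finset.sum_congr rfl fun m _ => ?_
  rw [integral_const_mul]
  ring

/-! ### Boosts -/

theorem continuous_lorentzDot_self : Continuous fun k : FourVector => lorentzDot k k := by
  unfold lorentzDot
  fun_prop

theorem measurable_mass : Measurable mass :=
  (Real.continuous_sqrt.comp continuous_lorentzDot_self).measurable

theorem measurableSet_futureCone : MeasurableSet futureCone :=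
  ((isOpen_lt continuous_const (continuous_apply 0)).inter
    (isOpen_lt continuous_const continuous_lorentzDot_self)).measurableSet

theorem mass_pos {k : FourVector} (hk : k ∈ futureCone) : 0 < mass k :=
  Real.sqrt_pos.2 hk.2

theorem mass_sq {k : FourVector} (hk : k ∈ futureCone) : mass k ^ 2 = lorentzDot k k :=
  Real.sq_sqrt hk.2.le

theorem zero_add_three_pos {k : FourVector} (hk : k ∈ futureCone) : 0 < k 0 + k 3 := by
  have h1 := hk.1
  have h2 := hk.2
  unfold lorentzDot at h2
  nlinarith [sq_nonneg (k 1), sq_nonneg (k 2)]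

open Classical in
/-- The square of the first diagonal element of `coneBoost k`. -/
noncomputable def coneWeight (k : FourVector) : ℝ :=
  if k ∈ futureCone then (k 0 + k 3) / mass k else 1

theorem coneWeight_pos (k : FourVector) : 0 < coneWeight k := by
  unfold coneWeight
  split_ifs with h
  · exact div_pos (zero_add_three_pos h) (mass_pos h)
  · exact one_pos

/-- The lower triangular element `b` of `SL(2, ℂ)` with positive diagonal such that
`Λ(b) (μ, 0, 0, 0) = k`, for `k` in the future cone of mass `μ`: it is the Cholesky factor
of the spinor matrix of `k / μ`, and depends continuously on `k`. -/
noncomputable def coneBoost (k : FourVector) : Matrix.SpecialLinearGroup (Fin 2) ℂ :=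
  ⟨!![(Real.sqrt (coneWeight k) : ℂ), 0;
      ((k 1 : ℂ) + Complex.I * k 2) / (mass k * Real.sqrt (coneWeight k)),
        (Real.sqrt (coneWeight k) : ℂ)⁻¹], by
    have h : (Real.sqrt (coneWeight k) : ℂ) ≠ 0 := by
      exact_mod_cast (Real.sqrt_pos.2 (coneWeight_pos k)).ne'
    rw [Matrix.det_fin_two_of, mul_inv_cancel₀ h]
    ring⟩

theorem spinorMatrix_restMomentum (μ : ℝ) :
    spinorMatrix (restMomentum μ) = (μ : ℂ) • (1 : Matrix (Fin 2) (Fin 2) ℂ) := by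
  ext i i'
  fin_cases i <;> fin_cases i' <;> simp [spinorMatrix, restMomentum]

theorem coneBoost_mul_conjTranspose {k : FourVector} (hk : k ∈ futureCone) :
    (mass k : ℂ) • ((coneBoost k : Matrix (Fin 2) (Fin 2) ℂ) *
      (coneBoost k : Matrix (Fin 2) (Fin 2) ℂ).conjTranspose) = spinorMatrix k := by
  have hμ := mass_pos hk
  have hp := zero_add_three_pos hk
  have hμ2 := mass_sq hk
  set s := Real.sqrt (coneWeight k) with hs
  have hs0 : 0 < s := Real.sqrt_pos.2 (coneWeight_pos k)
  have hs2 : mass k * s ^ 2 = k 0 + k 3 := by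
    rw [hs, Real.sq_sqrt (coneWeight_pos k).le, coneWeight, if_pos hk]
    field_simp
  have hsC : (s : ℂ) ≠ 0 := by exact_mod_cast hs0.ne'
  have hμC : (mass k : ℂ) ≠ 0 := by exact_mod_cast hμ.ne'
  have hs2C : (mass k : ℂ) * (s : ℂ) ^ 2 = k 0 + k 3 := by exact_mod_cast hs2
  have hμ2C : (mass k : ℂ) ^ 2 = (k 0 : ℂ) * k 0 - k 1 * k 1 - k 2 * k 2 - k 3 * k 3 := by
    rw [lorentzDot] at hμ2
    exact_mod_cast hμ2
  ext i i'
  rw [Matrix.smul_apply, Matrix.mul_apply, Fin.sum_univ_two, Matrix.conjTranspose_apply,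
    Matrix.conjTranspose_apply]
  fin_cases i <;> fin_cases i' <;> simp [coneBoost, spinorMatrix, ← hs]
  · linear_combination hs2C
  · field_simp
    ring
  · field_simp
  · field_simp
    linear_combination -(k 2 : ℂ) ^ 2 * Complex.I_sq + hμ2C -
      ((k 0 : ℂ) - k 3) * hs2C

/-- Two elements which give the same vector differ by a rotation. -/
theorem inv_mul_unitary {a b : Matrix.SpecialLinearGroup (Fin 2) ℂ}
    (h : (a : Matrix (Fin 2) (Fin 2) ℂ) * (a : Matrix (Fin 2) (Fin 2) ℂ).conjTranspose =
      (b : Matrix (Fin 2) (Fin 2) ℂ) * (b : Matrix (Fin 2) (Fin 2) ℂ).conjTranspose) :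
    ((a⁻¹ * b : Matrix.SpecialLinearGroup (Fin 2) ℂ) : Matrix (Fin 2) (Fin 2) ℂ) *
      ((a⁻¹ * b : Matrix.SpecialLinearGroup (Fin 2) ℂ) :
        Matrix (Fin 2) (Fin 2) ℂ).conjTranspose = 1 := by
  have h1 : ((a⁻¹ : Matrix.SpecialLinearGroup (Fin 2) ℂ) : Matrix (Fin 2) (Fin 2) ℂ) *
      (a : Matrix (Fin 2) (Fin 2) ℂ) = 1 := by
    rw [← Matrix.SpecialLinearGroup.coe_mul, inv_mul_cancel, Matrix.SpecialLinearGroup.coe_one]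
  rw [Matrix.SpecialLinearGroup.coe_mul, Matrix.conjTranspose_mul]
  set A := (a : Matrix (Fin 2) (Fin 2) ℂ)
  set A' := ((a⁻¹ : Matrix.SpecialLinearGroup (Fin 2) ℂ) : Matrix (Fin 2) (Fin 2) ℂ)
  set B := (b : Matrix (Fin 2) (Fin 2) ℂ)
  calc A' * B * (B.conjTranspose * A'.conjTranspose)
      = A' * (B * B.conjTranspose) * A'.conjTranspose := by simp only [Matrix.mul_assoc]
    _ = (A' * A) * (A' * A).conjTranspose := by
        rw [← h, Matrix.conjTranspose_mul]; simp only [Matrix.mul_assoc]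
    _ = 1 := by rw [h1]; simp

theorem coe_inv_mul_apply (a b : Matrix.SpecialLinearGroup (Fin 2) ℂ) (i i' : Fin 2) :
    (a⁻¹ * b) i i' = (!![a 1 1, -a 0 1; -a 1 0, a 0 0] * (b : Matrix (Fin 2) (Fin 2) ℂ)) i i' := by
  rw [Matrix.SpecialLinearGroup.coe_mul, Matrix.SpecialLinearGroup.coe_inv,
    Matrix.adjugate_fin_two]

theorem measurable_inv_mul {Ω : Type*} [MeasurableSpace Ω]
    {a b : Ω → Matrix.SpecialLinearGroup (Fin 2) ℂ} (ha : ∀ i i', Measurable fun ω => a ω i i')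
    (hb : ∀ i i', Measurable fun ω => b ω i i') (i i' : Fin 2) :
    Measurable fun ω => ((a ω)⁻¹ * b ω) i i' := by
  have h00 := ha 0 0
  have h01 := ha 0 1
  have h10 := ha 1 0
  have h11 := ha 1 1
  have h0 := hb 0 i'
  have h1 := hb 1 i'
  simp only [coe_inv_mul_apply, Matrix.mul_apply, Fin.sum_univ_two]
  fin_cases i
  · exact (h11.mul h0).add (h01.neg.mul h1)
  · exact (h10.neg.mul h0).add (h00.mul h1)

theorem measurable_coneWeight : Measurable coneWeight := by
  classical
  unfold coneWeight
  refine Measurable.ite measurableSet_futureCone ?_ measurable_const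
  exact Measurable.div (by fun_prop) measurable_mass

theorem measurable_coneBoost (i i' : Fin 2) : Measurable fun k => coneBoost k i i' := by
  have h1 := measurable_coneWeight
  have h2 := measurable_mass
  fin_cases i <;> fin_cases i' <;> simp [coneBoost] <;> fun_prop

/-! ### Large energies -/

theorem lorentzDot_add_rest (k : FourVector) (t : ℝ) :
    lorentzDot (k + restMomentum t) (k + restMomentum t) =
      lorentzDot k k + 2 * t * k 0 + t ^ 2 := by
  simp [lorentzDot, restMomentum]
  ring

theorem tendsto_lorentzDot_div (k : FourVector) :
    Tendsto (fun n : ℕ => lorentzDot (k + restMomentum n) (k + restMomentum n) / (n : ℝ) ^ 2)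
      atTop (𝓝 1) := by
  have h0 : Tendsto (fun n : ℕ => (n : ℝ)⁻¹) atTop (𝓝 0) := tendsto_inv_atTop_nhds_zero_nat
  have h : Tendsto (fun n : ℕ => lorentzDot k k * (n : ℝ)⁻¹ ^ 2 + 2 * k 0 * (n : ℝ)⁻¹ + 1)
      atTop (𝓝 (lorentzDot k k * 0 ^ 2 + 2 * k 0 * 0 + 1)) :=
    (((h0.pow 2).const_mul _).add (h0.const_mul _)).add_const 1
  rw [show lorentzDot k k * 0 ^ 2 + 2 * k 0 * 0 + 1 = 1 by ring] at h
  refine h.congr' ?_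
  filter_upwards [eventually_gt_atTop 0] with n hn
  have : (n : ℝ) ≠ 0 := by positivity
  rw [lorentzDot_add_rest]
  field_simp

theorem tendsto_mass_div (k : FourVector) :
    Tendsto (fun n : ℕ => mass (k + restMomentum n) / n) atTop (𝓝 1) := by
  have h := (Real.continuous_sqrt.tendsto 1).comp (tendsto_lorentzDot_div k)
  rw [Real.sqrt_one] at h
  refine h.congr fun n => ?_
  simp only [Function.comp_apply, mass]
  rw [Real.sqrt_div' _ (by positivity), Real.sqrt_sq (by positivity)]

theorem tendsto_mass_atTop (k : FourVector) :
    Tendsto (fun n : ℕ => mass (k + restMomentum n)) atTop atTop := by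
  have h := (tendsto_mass_div k).pos_mul_atTop one_pos tendsto_natCast_atTop_atTop
  refine h.congr' ?_
  filter_upwards [eventually_gt_atTop 0] with n hn
  exact div_mul_cancel₀ _ (by positivity)

theorem eventually_mem_futureCone (k : FourVector) :
    ∀ᶠ n : ℕ in atTop, k + restMomentum n ∈ futureCone := by
  have h1 : Tendsto (fun n : ℕ => k 0 + (n : ℝ)) atTop atTop :=
    tendsto_atTop_add_const_left _ _ tendsto_natCast_atTop_atTop
  filter_upwards [h1.eventually_gt_atTop 0, (tendsto_mass_atTop k).eventually_gt_atTop 0]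
    with n hn hm
  exact ⟨by simpa [restMomentum] using hn, Real.sqrt_pos.1 hm⟩

theorem tendsto_mass_sub (k k' : FourVector) :
    Tendsto (fun n : ℕ => mass (k + restMomentum n) - mass (k' + restMomentum n)) atTop
      (𝓝 (k 0 - k' 0)) := by
  have h0 : Tendsto (fun n : ℕ => (n : ℝ)⁻¹) atTop (𝓝 0) := tendsto_inv_atTop_nhds_zero_nat
  have h := (((h0.const_mul (lorentzDot k k - lorentzDot k' k')).add_const
    (2 * (k 0 - k' 0)))).div ((tendsto_mass_div k).add (tendsto_mass_div k')) (by norm_num)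
  rw [show ((lorentzDot k k - lorentzDot k' k') * 0 + 2 * (k 0 - k' 0)) / (1 + 1) =
    k 0 - k' 0 by ring] at h
  refine h.congr' ?_
  filter_upwards [eventually_gt_atTop 0, eventually_mem_futureCone k,
    eventually_mem_futureCone k'] with n hn hk hk'
  have hn' : (n : ℝ) ≠ 0 := by positivity
  have h1 := mass_sq hk
  have h2 := mass_sq hk'
  have h3 := mass_pos hk
  have h4 := mass_pos hk'
  -- The terms of order `n²` cancel in the difference of the squares of the masses.
  rw [lorentzDot_add_rest] at h1 h2
  simp only [Pi.div_apply]
  rw [← add_div, div_eq_iff (by positivity)]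
  field_simp
  linear_combination h2 - h1

theorem tendsto_coneWeight (k : FourVector) :
    Tendsto (fun n : ℕ => coneWeight (k + restMomentum n)) atTop (𝓝 1) := by
  have h0 : Tendsto (fun n : ℕ => (n : ℝ)⁻¹) atTop (𝓝 0) := tendsto_inv_atTop_nhds_zero_nat
  have h := ((h0.const_mul (k 0 + k 3)).add_const 1).div (tendsto_mass_div k) one_ne_zero
  rw [show ((k 0 + k 3) * 0 + 1) / 1 = (1 : ℝ) by ring] at h
  refine h.congr' ?_
  filter_upwards [eventually_gt_atTop 0, eventually_mem_futureCone k] with n hn hk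
  have hn' : (n : ℝ) ≠ 0 := by positivity
  have h3 := mass_pos hk
  rw [coneWeight, if_pos hk]
  simp only [Pi.div_apply]
  have e : (k + restMomentum n) 0 + (k + restMomentum n) 3 = k 0 + k 3 + n := by
    simp [restMomentum]; ring
  rw [e]
  field_simp

theorem tendsto_coneBoost (k : FourVector) (i i' : Fin 2) :
    Tendsto (fun n : ℕ => coneBoost (k + restMomentum n) i i') atTop
      (𝓝 ((1 : Matrix (Fin 2) (Fin 2) ℂ) i i')) := by
  have hs : Tendsto (fun n : ℕ => (Real.sqrt (coneWeight (k + restMomentum n)) : ℂ)) atTop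
      (𝓝 1) := by
    have h := (Real.continuous_sqrt.tendsto 1).comp (tendsto_coneWeight k)
    rw [Real.sqrt_one] at h
    exact_mod_cast (Complex.continuous_ofReal.tendsto 1).comp h
  have hμ : Tendsto (fun n : ℕ => (mass (k + restMomentum n) : ℂ)⁻¹) atTop (𝓝 0) := by
    have h := (Complex.continuous_ofReal.tendsto 0).comp
      (tendsto_inv_atTop_zero.comp (tendsto_mass_atTop k))
    simpa [Function.comp_def] using h
  have hsi := hs.inv₀ one_ne_zero
  rw [inv_one] at hsi
  fin_cases i <;> fin_cases i'
  · simpa [coneBoost] using hs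
  · simp [coneBoost]
  · have h := (hμ.mul hsi).const_mul ((k 1 : ℂ) + Complex.I * k 2)
    simpa [coneBoost, restMomentum, div_eq_mul_inv, mul_comm, mul_left_comm, mul_assoc] using h
  · simpa [coneBoost] using hsi

/-- At large energies the velocities coincide and the relative boost disappears. -/
theorem tendsto_repD_coneBoost (J : ℕ) (k k' : FourVector) :
    Tendsto (fun n : ℕ => repD J ((coneBoost (k' + restMomentum n))⁻¹ *
      coneBoost (k + restMomentum n)) 0 0) atTop (𝓝 1) := by
  refine tendsto_repD J fun i i' => ?_
  have hb := tendsto_coneBoost k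
  have hb' := tendsto_coneBoost k'
  simp only [coe_inv_mul_apply, Matrix.mul_apply, Fin.sum_univ_two]
  fin_cases i
  · simpa [Matrix.one_apply] using
      ((hb' 1 1).mul (hb 0 i')).add ((hb' 0 1).neg.mul (hb 1 i'))
  · simpa [Matrix.one_apply] using
      ((hb' 1 0).neg.mul (hb 0 i')).add ((hb' 0 0).mul (hb 1 i'))

/-! ### The multiplicity spaces -/

section Contraction

variable {S N : Type*} {F : N → S → ℂ} {c : S → ℂ}

theorem memℓp_sum_mul
    (h : ∀ s : Finset S, ∑' ν, ‖∑ σ ∈ s, F ν σ * c σ‖ₑ ^ 2 ≤ ∑ σ ∈ s, ‖c σ‖ₑ ^ 2)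
    (s : Finset S) : Memℓp (fun ν => ∑ σ ∈ s, F ν σ * c σ) 2 := by
  refine memℓp_gen ?_
  have hfin : ∑' ν, ‖∑ σ ∈ s, F ν σ * c σ‖ₑ ^ 2 ≠ ∞ :=
    ((h s).trans_lt (ENNReal.sum_lt_top.2 fun σ _ => by simp)).ne
  have := ENNReal.summable_toReal hfin
  simpa using this

/-- The partial sums of `∑_σ F_{νσ} c_σ`, as elements of `ℓ²`. -/
noncomputable def partialAmplitude
    (h : ∀ s : Finset S, ∑' ν, ‖∑ σ ∈ s, F ν σ * c σ‖ₑ ^ 2 ≤ ∑ σ ∈ s, ‖c σ‖ₑ ^ 2)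
    (s : Finset S) : lp (fun _ : N => ℂ) 2 :=
  ⟨fun ν => ∑ σ ∈ s, F ν σ * c σ, memℓp_sum_mul h s⟩

theorem norm_partialAmplitude_sq_le
    (h : ∀ s : Finset S, ∑' ν, ‖∑ σ ∈ s, F ν σ * c σ‖ₑ ^ 2 ≤ ∑ σ ∈ s, ‖c σ‖ₑ ^ 2)
    (s : Finset S) : ‖partialAmplitude h s‖ ^ 2 ≤ ∑ σ ∈ s, ‖c σ‖ ^ 2 := by
  have h1 := lp.norm_rpow_eq_tsum (p := 2) (by norm_num) (partialAmplitude h s)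
  simp only [ENNReal.toReal_ofNat, Real.rpow_ofNat] at h1
  rw [h1]
  have hfin : ∑ σ ∈ s, ‖c σ‖ₑ ^ 2 ≠ ∞ := (ENNReal.sum_lt_top.2 fun σ _ => by simp).ne
  have h2 := ENNReal.toReal_mono hfin (h s)
  rw [ENNReal.tsum_toReal_eq fun ν => by simp, ENNReal.toReal_sum fun σ _ => by simp] at h2
  simpa [partialAmplitude] using h2

theorem sum_partialAmplitude_singleton
    (h : ∀ s : Finset S, ∑' ν, ‖∑ σ ∈ s, F ν σ * c σ‖ₑ ^ 2 ≤ ∑ σ ∈ s, ‖c σ‖ₑ ^ 2)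
    (s : Finset S) : ∑ σ ∈ s, partialAmplitude h {σ} = partialAmplitude h s := by
  ext ν
  rw [lp.coeFn_sum]
  simp [partialAmplitude]

/-- If `c` is square summable, `∑_σ F_{νσ} c_σ` converges in `ℓ²`. -/
theorem exists_tendsto_partialAmplitude
    (h : ∀ s : Finset S, ∑' ν, ‖∑ σ ∈ s, F ν σ * c σ‖ₑ ^ 2 ≤ ∑ σ ∈ s, ‖c σ‖ₑ ^ 2)
    (hc : Summable fun σ => ‖c σ‖ ^ 2) :
    ∃ A : lp (fun _ : N => ℂ) 2, Tendsto (partialAmplitude h) atTop (𝓝 A) ∧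
      ∀ ν, A ν = ∑' σ, F ν σ * c σ := by
  have hs : Summable fun σ => partialAmplitude h {σ} := by
    rw [summable_iff_vanishing_norm] at hc ⊢
    intro ε hε
    obtain ⟨s, hs⟩ := hc (ε ^ 2) (by positivity)
    refine ⟨s, fun t ht => ?_⟩
    rw [sum_partialAmplitude_singleton]
    have h1 := (norm_partialAmplitude_sq_le h t).trans_lt ((le_abs_self _).trans_lt (hs t ht))
    exact lt_of_pow_lt_pow_left₀ 2 hε.le h1
  have ht : Tendsto (partialAmplitude h) atTop (𝓝 (∑' σ, partialAmplitude h {σ})) := by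
    have := hs.hasSum
    simp only [HasSum, SummationFilter.unconditional_filter, sum_partialAmplitude_singleton] at this
    exact this
  refine ⟨_, ht, fun ν => ?_⟩
  have hν : HasSum (fun σ => F ν σ * c σ) ((∑' σ, partialAmplitude h {σ} : lp _ 2) ν) := by
    have := ((lp.evalCLM ℂ (fun _ : N => ℂ) (p := 2) ν).continuous.tendsto _).comp ht
    rw [HasSum, SummationFilter.unconditional_filter]
    exact this
  exact hν.tsum_eq.symm

end Contraction

namespace QuasiBaricentricData

variable {S N : Type*} (Q : QuasiBaricentricData S N)

/-- The masses at which the coefficients `F^j_{νσ}` define a contraction. -/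
def IsContractive (J : ℕ) (μ : ℝ) : Prop :=
  ∀ c : S →₀ ℂ, (∀ σ ∈ c.support, μ ∈ Q.spectrum J σ) →
    ∑' ν, ‖∑ σ ∈ c.support, Q.F J ν σ μ * c σ‖ₑ ^ 2 ≤ ∑ σ ∈ c.support, ‖c σ‖ₑ ^ 2

open Classical in
theorem IsContractive.sum_le {Q : QuasiBaricentricData S N} {J : ℕ} {μ : ℝ}
    (h : Q.IsContractive J μ) {c : S → ℂ} (hc : ∀ σ, μ ∉ Q.spectrum J σ → c σ = 0)
    (s : Finset S) :
    ∑' ν, ‖∑ σ ∈ s, Q.F J ν σ μ * c σ‖ₑ ^ 2 ≤ ∑ σ ∈ s, ‖c σ‖ₑ ^ 2 := by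
  set c' : S →₀ ℂ := Finsupp.indicator s fun σ _ => c σ with hc'
  have hsub : c'.support ⊆ s := Finsupp.support_indicator_subset _ _
  have happ : ∀ σ ∈ s, c' σ = c σ := fun σ hσ => Finsupp.indicator_of_mem hσ _
  have hz : ∀ σ ∈ s, σ ∉ c'.support → c σ = 0 := fun σ hσ hn => by
    rw [← happ σ hσ]
    exact Finsupp.notMem_support_iff.1 hn
  have h1 := h c' fun σ hσ => by
    by_contra hcon
    exact Finsupp.mem_support_iff.1 hσ (by rw [happ σ (hsub hσ), hc σ hcon])
  have e1 : ∀ ν, ∑ σ ∈ c'.support, Q.F J ν σ μ * c' σ = ∑ σ ∈ s, Q.F J ν σ μ * c σ := fun ν => by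
    rw [← Finset.sum_subset hsub fun σ hσ hn => by rw [hz σ hσ hn, mul_zero]]
    exact Finset.sum_congr rfl fun σ hσ => by rw [happ σ (hsub hσ)]
  have e2 : ∑ σ ∈ c'.support, ‖c' σ‖ₑ ^ 2 = ∑ σ ∈ s, ‖c σ‖ₑ ^ 2 := by
    rw [← Finset.sum_subset hsub fun σ hσ hn => by rw [hz σ hσ hn]; simp]
    exact Finset.sum_congr rfl fun σ hσ => by rw [happ σ (hsub hσ)]
  simpa only [e1, e2] using h1

/-- The sum over `σ` and `σ'` in `r̂` factorizes; no convergence is needed, since the factors that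
do not depend on the summation index can be taken out of any (possibly divergent) sum. -/
theorem rHat_eq (J : ℕ) (c : S → ℝ → ℂ) (μ' μ : ℝ) :
    Q.rHat J c μ' μ = ∑' ν, conj (∑' σ, Q.F J ν σ μ' * c σ μ') * ∑' σ, Q.F J ν σ μ * c σ μ := by
  unfold rHat
  congr 1
  ext ν
  rw [Complex.conj_tsum, ← tsum_mul_right]
  congr 1
  ext σ'
  rw [← tsum_mul_left]
  congr 1
  ext σ
  rw [map_mul]
  ring

open Classical in
/-- The functions `c_σ` with `σ` in a finite set, the others being replaced by zero. -/
noncomputable def cutoff (s : Finset S) (c : S → ℝ → ℂ) (σ : S) (μ : ℝ) : ℂ :=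
  if σ ∈ s then c σ μ else 0

theorem rHat_cutoff (J : ℕ) (s : Finset S) (c : S → ℝ → ℂ) (μ' μ : ℝ) :
    Q.rHat J (cutoff s c) μ' μ =
      ∑' ν, conj (∑ σ ∈ s, Q.F J ν σ μ' * c σ μ') * ∑ σ ∈ s, Q.F J ν σ μ * c σ μ := by
  have h : ∀ ν μ, ∑' σ, Q.F J ν σ μ * cutoff s c σ μ = ∑ σ ∈ s, Q.F J ν σ μ * c σ μ := by
    intro ν μ
    rw [tsum_eq_sum (s := s) fun σ hσ => by simp [cutoff, hσ]]
    exact Finset.sum_congr rfl fun σ hσ => by simp [cutoff, hσ]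
  simp only [rHat_eq, h]

section

variable {Q} {J : ℕ} {c : S → ℝ → ℂ} {μ' μ : ℝ}

theorem norm_rHat_cutoff_le (hc : ∀ σ μ, μ ∉ Q.spectrum J σ → c σ μ = 0)
    (h' : Q.IsContractive J μ') (h : Q.IsContractive J μ)
    (hc' : HasSum (fun σ => ‖c σ μ'‖ ^ 2) 1) (hc1 : HasSum (fun σ => ‖c σ μ‖ ^ 2) 1)
    (s : Finset S) : ‖Q.rHat J (cutoff s c) μ' μ‖ ≤ 1 := by
  have g' := h'.sum_le (c := fun σ => c σ μ') fun σ => hc σ μ'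
  have g := h.sum_le (c := fun σ => c σ μ) fun σ => hc σ μ
  have e : Q.rHat J (cutoff s c) μ' μ =
      inner ℂ (partialAmplitude g' s) (partialAmplitude g s) := by
    rw [rHat_cutoff, lp.inner_eq_tsum]
    simp [partialAmplitude, mul_comm]
  have b' : ‖partialAmplitude g' s‖ ≤ 1 := by
    have := (norm_partialAmplitude_sq_le g' s).trans
      (sum_le_hasSum s (fun σ _ => by positivity) hc')
    exact (sq_le_one_iff₀ (norm_nonneg _)).1 this
  have b : ‖partialAmplitude g s‖ ≤ 1 := by
    have := (norm_partialAmplitude_sq_le g s).trans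
      (sum_le_hasSum s (fun σ _ => by positivity) hc1)
    exact (sq_le_one_iff₀ (norm_nonneg _)).1 this
  rw [e]
  exact (norm_inner_le_norm _ _).trans (mul_le_one₀ b' (norm_nonneg _) b)

theorem tendsto_rHat_cutoff (hc : ∀ σ μ, μ ∉ Q.spectrum J σ → c σ μ = 0)
    (h' : Q.IsContractive J μ') (h : Q.IsContractive J μ)
    (hc' : HasSum (fun σ => ‖c σ μ'‖ ^ 2) 1) (hc1 : HasSum (fun σ => ‖c σ μ‖ ^ 2) 1) :
    Tendsto (fun s => Q.rHat J (cutoff s c) μ' μ) atTop (𝓝 (Q.rHat J c μ' μ)) := by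
  have g' := h'.sum_le (c := fun σ => c σ μ') fun σ => hc σ μ'
  have g := h.sum_le (c := fun σ => c σ μ) fun σ => hc σ μ
  have e : ∀ s, Q.rHat J (cutoff s c) μ' μ =
      inner ℂ (partialAmplitude g' s) (partialAmplitude g s) := by
    intro s
    rw [rHat_cutoff, lp.inner_eq_tsum]
    simp [partialAmplitude, mul_comm]
  obtain ⟨A', hA', e'⟩ := exists_tendsto_partialAmplitude g' hc'.summable
  obtain ⟨A, hA, e''⟩ := exists_tendsto_partialAmplitude g hc1.summable
  have e1 : Q.rHat J c μ' μ = inner ℂ A' A := by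
    rw [rHat_eq, lp.inner_eq_tsum]
    simp [e', e'', mul_comm]
  simp only [e, e1]
  exact hA'.inner hA

end

theorem measurable_rHat [Countable S] [Countable N] (J : ℕ) {c : S → ℝ → ℂ}
    (hc : ∀ σ, Measurable (c σ)) : Measurable fun p : ℝ × ℝ => Q.rHat J c p.1 p.2 := by
  simp only [rHat_eq]
  have h : ∀ ν, Measurable fun μ => ∑' σ, Q.F J ν σ μ * c σ μ := fun ν =>
    Measurable.tsum fun σ => (Q.measurable_F J ν σ).mul (hc σ)
  refine Measurable.tsum fun ν => Measurable.mul ?_ ((h ν).comp measurable_snd)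
  exact Complex.continuous_conj.measurable.comp ((h ν).comp measurable_fst)

end QuasiBaricentricData

theorem measurable_cutoff {S : Type*} (s : Finset S) {c : S → ℝ → ℂ}
    (hc : ∀ σ, Measurable (c σ)) (σ : S) :
    Measurable (QuasiBaricentricData.cutoff s c σ) := by
  unfold QuasiBaricentricData.cutoff
  split_ifs
  · exact hc σ
  · exact measurable_const

/-! ### The mass as a function on the future cone -/

/-- A property that holds for almost all masses holds for the masses of almost all the vectors of
the future cone: the exceptional vectors form the image of a null set under the differentiable
map `(μ, k¹, k², k³) ↦ k`. -/
theorem ae_mass {p : ℝ → Prop} (h : ∀ᵐ μ ∂(volume.restrict (Set.Ioi (0 : ℝ))), p μ) :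
    ∀ᵐ k : FourVector, k ∈ futureCone → p (mass k) := by
  rw [ae_restrict_iff' measurableSet_Ioi] at h
  have h0 : ∀ᵐ y : FourVector, 0 < y 0 → p (y 0) :=
    (Measure.quasiMeasurePreserving_eval (fun _ : Fin 4 => (volume : Measure ℝ)) 0).ae h
  let g : FourVector → FourVector := fun y =>
    ![Real.sqrt (y 0 ^ 2 + y 1 ^ 2 + y 2 ^ 2 + y 3 ^ 2), y 1, y 2, y 3]
  have hg : DifferentiableOn ℝ g {y | ¬(0 < y 0 → p (y 0))} := by
    intro y hy
    rw [differentiableWithinAt_pi]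
    have hy0 : 0 < y 0 := by
      by_contra hcon
      exact hy fun h => absurd h hcon
    have hd : ∀ i, Differentiable ℝ fun y : FourVector => y i := fun i => by fun_prop
    intro i
    fin_cases i
    · refine DifferentiableWithinAt.sqrt (by fun_prop) ?_
      have : 0 < y 0 ^ 2 := by positivity
      positivity
    · exact (hd 1).differentiableAt.differentiableWithinAt
    · exact (hd 2).differentiableAt.differentiableWithinAt
    · exact (hd 3).differentiableAt.differentiableWithinAt
  refine measure_mono_null ?_
    (addHaar_image_eq_zero_of_differentiableOn_of_addHaar_eq_zero volume hg (ae_iff.1 h0))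
  intro k hk
  have hkV : k ∈ futureCone := by
    by_contra hcon
    exact hk fun h => absurd h hcon
  have hm := mass_sq hkV
  rw [lorentzDot] at hm
  refine ⟨![mass k, k 1, k 2, k 3], ?_, ?_⟩
  · intro hcon
    exact hk fun _ => hcon (mass_pos hkV)
  · ext i
    fin_cases i
    · simp only [g, Matrix.cons_val_zero, Matrix.cons_val_one, Matrix.cons_val]
      rw [hm]
      exact (Real.sqrt_eq_iff_eq_sq (by ring_nf; positivity) hkV.1.le).2 (by ring)
    · rfl
    · rfl
    · rfl

namespace QuasiBaricentricData

variable {S N : Type*} (Q : QuasiBaricentricData S N)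

/-! ### The wave functions of the test states -/

/-- The rotation by which `coneBoost k` and the chosen element `a_k` differ. -/
noncomputable def boostRotation (k : FourVector) : Matrix.SpecialLinearGroup (Fin 2) ℂ :=
  (Q.boost k)⁻¹ * coneBoost k

theorem boostRotation_unitary {k : FourVector} (hk : k ∈ futureCone) :
    (Q.boostRotation k : Matrix (Fin 2) (Fin 2) ℂ) *
      (Q.boostRotation k : Matrix (Fin 2) (Fin 2) ℂ).conjTranspose = 1 := by
  refine inv_mul_unitary ?_
  have hμ : (mass k : ℂ) ≠ 0 := by exact_mod_cast (mass_pos hk).ne'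
  have h := Q.boost_rest k hk
  rw [← coneBoost_mul_conjTranspose hk, spinorMatrix_restMomentum, Matrix.mul_smul, Matrix.mul_one,
    Matrix.smul_mul] at h
  exact smul_right_injective _ hμ h

/-- The dependence on the spin component of the test wave functions. -/
noncomputable def spinAmplitude (J : ℕ) (m : Fin (J + 1)) (k : FourVector) : ℂ :=
  rotated J m (Q.boostRotation k 0 1) (Q.boostRotation k 1 1)

theorem measurable_spinAmplitude (J : ℕ) (m : Fin (J + 1)) : Measurable (Q.spinAmplitude J m) := by
  have h := measurable_inv_mul Q.measurable_boost measurable_coneBoost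
  have h0 : Measurable fun k => Q.boostRotation k 0 1 := h 0 1
  have h1 : Measurable fun k => Q.boostRotation k 1 1 := h 1 1
  exact ((h0.pow_const _).const_mul _).mul (h1.pow_const _)

theorem sum_norm_spinAmplitude (J : ℕ) {k : FourVector} (hk : k ∈ futureCone) :
    ∑ m, ‖Q.spinAmplitude J m k‖ ^ 2 = 1 := by
  refine sum_norm_rotated J ?_
  have h := congrArg (fun A : Matrix (Fin 2) (Fin 2) ℂ => A 1 1)
    (mul_eq_one_comm.1 (Q.boostRotation_unitary hk))
  simp only [Matrix.mul_apply, Fin.sum_univ_two, Matrix.conjTranspose_apply, RCLike.star_def,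
    Complex.conj_mul', Matrix.one_apply_eq] at h
  exact_mod_cast h

theorem sum_repD_spinAmplitude (J : ℕ) {k k' : FourVector} (hk : k ∈ futureCone)
    (hk' : k' ∈ futureCone) :
    ∑ m', ∑ m, repD J ((Q.boost k')⁻¹ * Q.boost k) m' m *
      conj (Q.spinAmplitude J m' k') * Q.spinAmplitude J m k =
      repD J ((coneBoost k')⁻¹ * coneBoost k) 0 0 :=
  sum_repD_rotated J (Q.boostRotation_unitary hk) (Q.boostRotation_unitary hk')

/-- The test wave functions: `c_σ(μ)` times the spin amplitudes and a common profile `h(k)`, for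
spin `J/2` and `σ` in the finite set `s`. -/
noncomputable def waveFun (J : ℕ) (c : S → ℝ → ℂ) (s : Finset S) (h : FourVector → ℂ)
    (i : Label S) (k : FourVector) : ℂ :=
  if i.1 = J then cutoff s c i.2.1 (mass k) * Q.spinAmplitude i.1 i.2.2 k * h k else 0

/-- The profile `h` is integrable and square integrable, and vanishes outside the future
cone and at the masses for which the vector `c` is not normalized. -/
structure IsProfile (c : S → ℝ → ℂ) (h : FourVector → ℂ) : Prop where
  measurable : Measurable h
  integrable : Integrable h
  memLp : MemLp h 2
  mem_cone : ∀ k, h k ≠ 0 → k ∈ futureCone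
  hasSum : ∀ k, h k ≠ 0 → HasSum (fun σ => ‖c σ (mass k)‖ ^ 2) 1

section

variable {Q} {J : ℕ} {c : S → ℝ → ℂ} {s : Finset S} {h : FourVector → ℂ}

theorem measurable_waveFun (hc : ∀ σ, Measurable (c σ)) (hh : IsProfile c h) (i : Label S) :
    Measurable (Q.waveFun J c s h i) := by
  unfold waveFun
  split_ifs
  · exact (((measurable_cutoff s hc _).comp measurable_mass).mul
      (Q.measurable_spinAmplitude _ _)).mul hh.measurable
  · exact measurable_const

open Classical in
/-- The labels of the non-zero components of the test states. -/
noncomputable def waveLabels (J : ℕ) (s : Finset S) : Finset (Label S) :=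
  (s ×ˢ (Finset.univ : Finset (Fin (J + 1)))).map (Function.Embedding.sigmaMk J)

theorem waveFun_eq_zero {i : Label S} (hi : i ∉ waveLabels J s) (k : FourVector) :
    Q.waveFun J c s h i k = 0 := by
  obtain ⟨J', σ, m⟩ := i
  unfold waveFun
  split_ifs with hJ
  · simp only at hJ
    subst hJ
    have : σ ∉ s := fun hσ => hi (by simp [waveLabels, hσ])
    simp [cutoff, this]
  · rfl

theorem sum_norm_waveFun_le (hh : IsProfile c h) (k : FourVector) :
    ∑ i ∈ waveLabels J s, ‖Q.waveFun J c s h i k‖ ^ 2 ≤ ‖h k‖ ^ 2 := by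
  by_cases hk : h k = 0
  · simp [waveFun, hk]
  have h1 : ∑ i ∈ waveLabels J s, ‖Q.waveFun J c s h i k‖ ^ 2 =
      (∑ σ ∈ s, ‖c σ (mass k)‖ ^ 2) * (∑ m, ‖Q.spinAmplitude J m k‖ ^ 2) * ‖h k‖ ^ 2 := by
    rw [waveLabels, Finset.sum_map, Finset.sum_product, Finset.sum_mul_sum, Finset.sum_mul]
    refine Finset.sum_congr rfl fun σ hσ => ?_
    rw [Finset.sum_mul]
    refine Finset.sum_congr rfl fun m _ => ?_
    rw [Function.Embedding.sigmaMk_apply]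
    simp [waveFun, cutoff, hσ, mul_pow]
  rw [h1, Q.sum_norm_spinAmplitude J (hh.mem_cone k hk), mul_one]
  exact mul_le_of_le_one_left (by positivity)
    (sum_le_hasSum s (fun σ _ => by positivity) (hh.hasSum k hk))

theorem norm_waveFun_le (hh : IsProfile c h) (i : Label S) (k : FourVector) :
    ‖Q.waveFun J c s h i k‖ ≤ ‖h k‖ := by
  by_cases hi : i ∈ waveLabels J s
  · have h1 := (Finset.single_le_sum (f := fun i => ‖Q.waveFun J c s h i k‖ ^ 2)
      (fun i _ => by positivity) hi).trans (sum_norm_waveFun_le hh k)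
    exact (sq_le_sq₀ (norm_nonneg _) (norm_nonneg _)).1 h1
  · rw [waveFun_eq_zero hi]
    simp

theorem memLp_waveFun (hc : ∀ σ, Measurable (c σ)) (hh : IsProfile c h) (i : Label S) :
    MemLp (Q.waveFun J c s h i) 2 (volume.restrict (Q.region i)) :=
  (hh.memLp.mono (measurable_waveFun hc hh i).aestronglyMeasurable
    (ae_of_all _ (norm_waveFun_le hh i))).restrict _

theorem toLp_waveFun_eq_zero (hc : ∀ σ, Measurable (c σ)) (hh : IsProfile c h) {i : Label S}
    (hi : i ∉ waveLabels J s) : (memLp_waveFun (Q := Q) (J := J) (s := s) hc hh i).toLp = 0 := by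
  have : Q.waveFun J c s h i = 0 := funext (waveFun_eq_zero hi)
  rw [Lp.eq_zero_iff_ae_eq_zero]
  filter_upwards [(memLp_waveFun (Q := Q) (J := J) (s := s) hc hh i).coeFn_toLp] with k hk
  rw [hk, this]

/-- The test states. -/
noncomputable def wave (J : ℕ) (s : Finset S) (hc : ∀ σ, Measurable (c σ)) (hh : IsProfile c h) :
    Q.WaveSpace :=
  ⟨fun i => (memLp_waveFun (Q := Q) (J := J) (s := s) hc hh i).toLp, by
    refine Memℓp.of_exponent_ge (memℓp_zero ?_) zero_le
    refine (waveLabels J s).finite_toSet.subset fun i hi => ?_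
    by_contra hcon
    exact hi (toLp_waveFun_eq_zero hc hh hcon)⟩

theorem coe_wave_ae (hc : ∀ σ, Measurable (c σ)) (hh : IsProfile c h) (i : Label S) :
    (wave (Q := Q) J s hc hh i : FourVector → ℂ) =ᵐ[volume.restrict (Q.region i)]
      Q.waveFun J c s h i :=
  (memLp_waveFun (Q := Q) (J := J) (s := s) hc hh i).coeFn_toLp

theorem isRegular_wave (hc : ∀ σ, Measurable (c σ)) (hh : IsProfile c h) :
    Q.IsRegular (wave J s hc hh) := by
  refine ⟨(waveLabels J s).finite_toSet.subset fun i hi => ?_, fun i => ?_⟩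
  · by_contra hcon
    exact hi (toLp_waveFun_eq_zero hc hh hcon)
  · refine Integrable.congr ?_ (coe_wave_ae hc hh i).symm
    exact (hh.integrable.mono (measurable_waveFun hc hh i).aestronglyMeasurable
      (ae_of_all _ (norm_waveFun_le hh i))).restrict

theorem norm_wave_sq_le (hc : ∀ σ, Measurable (c σ)) (hh : IsProfile c h) :
    ‖wave (Q := Q) J s hc hh‖ ^ 2 ≤ ∫ k, ‖h k‖ ^ 2 := by
  have hint : Integrable fun k => ‖h k‖ ^ 2 := hh.memLp.integrable_norm_pow two_ne_zero
  have hinti : ∀ i, Integrable fun k => ‖Q.waveFun J c s h i k‖ ^ 2 := fun i =>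
    hint.mono' ((measurable_waveFun hc hh i).norm.pow_const 2).aestronglyMeasurable
      (ae_of_all _ fun k => by
        rw [Real.norm_of_nonneg (by positivity)]
        exact pow_le_pow_left₀ (norm_nonneg _) (norm_waveFun_le hh i k) 2)
  have h1 := lp.norm_rpow_eq_tsum (p := 2) (by norm_num) (wave (Q := Q) J s hc hh)
  simp only [ENNReal.toReal_ofNat, Real.rpow_ofNat] at h1
  rw [h1, tsum_eq_sum (s := waveLabels J s) fun i hi => by
    have : wave (Q := Q) J s hc hh i = 0 := toLp_waveFun_eq_zero hc hh hi
    rw [this]; simp]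
  have h2 : ∀ i, ‖wave (Q := Q) J s hc hh i‖ ^ 2 ≤ ∫ k, ‖Q.waveFun J c s h i k‖ ^ 2 := by
    intro i
    have e : ‖wave (Q := Q) J s hc hh i‖ ^ 2 =
        ∫ k in Q.region i, ‖Q.waveFun J c s h i k‖ ^ 2 := by
      have e1 := L2.inner_def (𝕜 := ℂ) (wave (Q := Q) J s hc hh i) (wave (Q := Q) J s hc hh i)
      have e2 : ∫ k in Q.region i, (inner ℂ ((wave (Q := Q) J s hc hh i : FourVector → ℂ) k)
          ((wave (Q := Q) J s hc hh i : FourVector → ℂ) k) : ℂ) =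
          ((∫ k in Q.region i, ‖Q.waveFun J c s h i k‖ ^ 2 : ℝ) : ℂ) := by
        rw [← integral_complex_ofReal]
        refine integral_congr_ae ?_
        filter_upwards [coe_wave_ae hc hh i] with k hk
        rw [hk, inner_self_eq_norm_sq_to_K]
        simp
      rw [e2, inner_self_eq_norm_sq_to_K] at e1
      exact Complex.ofReal_injective (by rw [Complex.ofReal_pow]; exact e1)
    rw [e]
    exact setIntegral_le_integral (hinti i) (ae_of_all _ fun k => by positivity)
  calc ∑ i ∈ waveLabels J s, ‖wave (Q := Q) J s hc hh i‖ ^ 2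
      ≤ ∑ i ∈ waveLabels J s, ∫ k, ‖Q.waveFun J c s h i k‖ ^ 2 :=
        Finset.sum_le_sum fun i _ => h2 i
    _ = ∫ k, ∑ i ∈ waveLabels J s, ‖Q.waveFun J c s h i k‖ ^ 2 :=
        (integral_finsetSum _ fun i _ => hinti i).symm
    _ ≤ ∫ k, ‖h k‖ ^ 2 := integral_mono (integrable_finsetSum _ fun i _ => hinti i) hint
        (sum_norm_waveFun_le hh)

theorem measurableSet_region (i : Label S) : MeasurableSet (Q.region i) :=
  measurableSet_futureCone.inter (measurable_mass (Q.measurableSet_spectrum i.1 i.2.1))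

/-- The components, which are defined by representatives of classes of functions, are almost
everywhere the explicit wave functions. -/
theorem component_wave_ae [Countable S] (hc : ∀ σ, Measurable (c σ))
    (hc0 : ∀ σ μ, μ ∉ Q.spectrum J σ → c σ μ = 0) (hh : IsProfile c h) :
    ∀ᵐ k, ∀ i : Label S,
      Q.component (wave J s hc hh) i.1 i.2.1 i.2.2 k = Q.waveFun J c s h i k := by
  rw [ae_all_iff]
  intro i
  have h1 := coe_wave_ae (Q := Q) (J := J) (s := s) hc hh i
  rw [EventuallyEq, ae_restrict_iff' (measurableSet_region i)] at h1
  filter_upwards [h1] with k hk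
  unfold component
  by_cases hki : k ∈ Q.region i
  · exact (Set.indicator_of_mem hki _).trans (hk hki)
  · refine (Set.indicator_of_notMem hki _).trans ?_
    unfold waveFun
    split_ifs with hJ
    · by_cases hz : h k = 0
      · rw [hz, mul_zero]
      · have : c i.2.1 (mass k) = 0 := by
          subst hJ
          exact hc0 _ _ fun hmem => hki ⟨hh.mem_cone k hz, hmem⟩
        simp [cutoff, this]
    · rfl

/-! ### The density of the test states -/

variable (Q) in
/-- The kernel that gives the density of the test states, apart from the profile: the product of
a matrix element of a relative boost and of `r̂`. -/
noncomputable def kernel (J : ℕ) (c : S → ℝ → ℂ) (k' k : FourVector) : ℂ :=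
  repD J ((coneBoost k')⁻¹ * coneBoost k) 0 0 * Q.rHat J c (mass k') (mass k)

theorem sum_mul_separated {ι κ : Type*} (s : Finset ι) (t : Finset κ) (A B : ι → ℂ)
    (X : κ → κ → ℂ) :
    ∑ σ' ∈ s, ∑ m' ∈ t, ∑ σ ∈ s, ∑ m ∈ t, A σ' * B σ * X m' m =
      (∑ m' ∈ t, ∑ m ∈ t, X m' m) * ((∑ σ' ∈ s, A σ') * ∑ σ ∈ s, B σ) := by
  simp only [← Finset.mul_sum, ← Finset.sum_mul]
  ring

/-- The sums in the density, evaluated on the test wave functions. -/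
theorem tsum_waveFun (hh : IsProfile c h) (k' k : FourVector) :
    ∑' (ν : N) (J' : ℕ) (σ' : S), ∑ m' : Fin (J' + 1), ∑' σ : S, ∑ m : Fin (J' + 1),
      repD J' ((Q.boost k')⁻¹ * Q.boost k) m' m *
        conj (Q.F J' ν σ' (mass k')) * Q.F J' ν σ (mass k) *
          conj (Q.waveFun J c s h ⟨J', σ', m'⟩ k') * Q.waveFun J c s h ⟨J', σ, m⟩ k =
      Q.kernel J (cutoff s c) k' k * (conj (h k') * h k) := by
  by_cases hk' : h k' = 0
  · simp [waveFun, hk']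
  by_cases hk : h k = 0
  · simp [waveFun, hk]
  rw [kernel, ← Q.sum_repD_spinAmplitude J (hh.mem_cone k hk) (hh.mem_cone k' hk'), rHat_cutoff,
    mul_right_comm, ← tsum_mul_left]
  congr 1
  ext ν
  rw [tsum_eq_single J fun J' hJ' => by simp [waveFun, hJ']]
  rw [tsum_eq_sum (s := s) fun σ' hσ' => by simp [waveFun, cutoff, hσ']]
  have h1 : ∀ σ' (m' : Fin (J + 1)), ∑' σ : S, ∑ m : Fin (J + 1),
      repD J ((Q.boost k')⁻¹ * Q.boost k) m' m *
        conj (Q.F J ν σ' (mass k')) * Q.F J ν σ (mass k) *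
          conj (Q.waveFun J c s h ⟨J, σ', m'⟩ k') * Q.waveFun J c s h ⟨J, σ, m⟩ k =
      ∑ σ ∈ s, ∑ m : Fin (J + 1), repD J ((Q.boost k')⁻¹ * Q.boost k) m' m *
        conj (Q.F J ν σ' (mass k')) * Q.F J ν σ (mass k) *
          conj (Q.waveFun J c s h ⟨J, σ', m'⟩ k') * Q.waveFun J c s h ⟨J, σ, m⟩ k :=
    fun σ' m' => tsum_eq_sum fun σ hσ => by simp [waveFun, cutoff, hσ]
  simp only [h1]
  have h2 := sum_mul_separated s Finset.univ
    (fun σ' => conj (Q.F J ν σ' (mass k') * c σ' (mass k')))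
    (fun σ => Q.F J ν σ (mass k) * c σ (mass k)) fun m' m =>
      repD J ((Q.boost k')⁻¹ * Q.boost k) m' m * conj (Q.spinAmplitude J m' k') *
        Q.spinAmplitude J m k
  rw [map_sum, mul_right_comm, ← h2, Finset.sum_mul]
  refine Finset.sum_congr rfl fun σ' hσ' => ?_
  rw [Finset.sum_mul]
  refine Finset.sum_congr rfl fun m' _ => ?_
  rw [Finset.sum_mul]
  refine Finset.sum_congr rfl fun σ hσ => ?_
  rw [Finset.sum_mul]
  refine Finset.sum_congr rfl fun m _ => ?_
  simp only [waveFun, cutoff, hσ, hσ', if_true, map_mul]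
  ring

theorem density_wave [Countable S] (hc : ∀ σ, Measurable (c σ))
    (hc0 : ∀ σ μ, μ ∉ Q.spectrum J σ → c σ μ = 0) (hh : IsProfile c h) (x : FourVector) :
    Q.density (wave J s hc hh) x = ((2 * Real.pi) ^ 4 : ℂ)⁻¹ *
      ∫ k', ∫ k, Complex.exp (Complex.I * (lorentzDot x (k' - k) : ℝ)) *
        (Q.kernel J (cutoff s c) k' k * (conj (h k') * h k)) := by
  unfold density
  have hz : ∀ k, k ∉ futureCone → h k = 0 := fun k hk => by
    by_contra hcon
    exact hk (hh.mem_cone k hcon)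
  have hcomp := component_wave_ae (s := s) hc hc0 hh
  congr 1
  rw [← setIntegral_eq_integral_of_forall_compl_eq_zero (s := futureCone)
    (f := fun k' => ∫ k, Complex.exp (Complex.I * (lorentzDot x (k' - k) : ℝ)) *
        (Q.kernel J (cutoff s c) k' k * (conj (h k') * h k))) fun k' hk' => by
    simp [hz k' hk']]
  refine integral_congr_ae (ae_restrict_of_ae ?_)
  filter_upwards [hcomp] with k' hk'
  rw [← setIntegral_eq_integral_of_forall_compl_eq_zero (s := futureCone)
    (f := fun k => Complex.exp (Complex.I * (lorentzDot x (k' - k) : ℝ)) *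
        (Q.kernel J (cutoff s c) k' k * (conj (h k') * h k))) fun k hk => by
    simp [hz k hk]]
  refine integral_congr_ae (ae_restrict_of_ae ?_)
  filter_upwards [hcomp] with k hk
  have e' : ∀ J' σ m, Q.component (wave J s hc hh) J' σ m k' = Q.waveFun J c s h ⟨J', σ, m⟩ k' :=
    fun J' σ m => hk' ⟨J', σ, m⟩
  have e : ∀ J' σ m, Q.component (wave J s hc hh) J' σ m k = Q.waveFun J c s h ⟨J', σ, m⟩ k :=
    fun J' σ m => hk ⟨J', σ, m⟩
  simp only [e, e']
  rw [tsum_waveFun hh]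

end

end QuasiBaricentricData

/-! ### Positive-operator-valued measures -/

namespace POVMeasure

variable {X : Type*} [MeasurableSpace X] {H : Type*} [NormedAddCommGroup H]
  [InnerProductSpace ℂ H] [CompleteSpace H] (τ : POVMeasure X H)

theorem inner_op_empty (φ ψ : H) : inner ℂ φ (τ.op ∅ ψ) = 0 := by
  have h := τ.hasSum_iUnion (fun _ => ∅) (fun _ => MeasurableSet.empty)
    (fun _ _ _ => disjoint_bot_left) φ ψ
  exact (summable_const_iff _).1 h.summable

theorem inner_op_union {A B : Set X} (hA : MeasurableSet A) (hB : MeasurableSet B)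
    (hAB : Disjoint A B) (φ ψ : H) :
    inner ℂ φ (τ.op (A ∪ B) ψ) = inner ℂ φ (τ.op A ψ) + inner ℂ φ (τ.op B ψ) := by
  let I : ℕ → Set X := fun n => if n = 0 then A else if n = 1 then B else ∅
  have h := τ.hasSum_iUnion I
    (fun n => by
      simp only [I]
      split_ifs <;> [exact hA; exact hB; exact MeasurableSet.empty])
    (fun m n hmn => by
      simp only [Function.onFun, I]
      split_ifs <;> simp_all [disjoint_comm]) φ ψ
  have hU : ⋃ n, I n = A ∪ B := by
    ext x
    simp only [Set.mem_iUnion, Set.mem_union, I]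
    constructor
    · rintro ⟨n, hn⟩
      split_ifs at hn <;> simp_all
    · rintro (hx | hx)
      · exact ⟨0, by simpa using hx⟩
      · exact ⟨1, by simpa using hx⟩
  rw [hU] at h
  refine h.unique ?_
  have h2 : HasSum (fun n => inner ℂ φ (τ.op (I n) ψ))
      (∑ n ∈ Finset.range 2, inner ℂ φ (τ.op (I n) ψ)) := by
    refine hasSum_sum_of_ne_finset_zero fun n hn => ?_
    have h0 : n ≠ 0 := by rintro rfl; simp at hn
    have h1 : n ≠ 1 := by rintro rfl; simp at hn
    simp only [I, h0, h1, if_false]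
    exact τ.inner_op_empty φ ψ
  simpa [Finset.sum_range_succ, I] using h2

theorem re_inner_op_mono {A B : Set X} (hA : MeasurableSet A) (hB : MeasurableSet B)
    (hAB : A ⊆ B) (φ : H) :
    (inner ℂ φ (τ.op A φ)).re ≤ (inner ℂ φ (τ.op B φ)).re := by
  have h := τ.inner_op_union hA (hB.diff hA) Set.disjoint_sdiff_right φ φ
  rw [Set.union_sdiff_cancel hAB] at h
  rw [h, Complex.add_re]
  exact le_add_of_nonneg_right ((τ.isPositive _ (hB.diff hA)).re_inner_nonneg_right φ)

theorem norm_op_le_one {A : Set X} (hA : MeasurableSet A) : ‖τ.op A‖ ≤ 1 := by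
  rw [CStarAlgebra.norm_le_one_iff_of_nonneg _
    ((ContinuousLinearMap.nonneg_iff_isPositive _).2 (τ.isPositive A hA)),
    ContinuousLinearMap.le_def]
  have h : (1 : H →L[ℂ] H) - τ.op A = (1 - τ.op Set.univ) + τ.op Aᶜ := by
    ext ψ
    refine ext_inner_left ℂ fun φ => ?_
    have h := τ.inner_op_union hA hA.compl disjoint_compl_right φ ψ
    rw [Set.union_compl_self] at h
    simp only [add_apply, sub_apply, inner_add_right,
      inner_sub_right, h]
    ring
  rw [h]
  exact τ.univ_le_one.add (τ.isPositive _ hA.compl)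

theorem re_inner_op_le {A B : Set X} (hA : MeasurableSet A) (hB : MeasurableSet B)
    (hAB : A ⊆ B) {φ : H} (hφ : ‖φ‖ ^ 2 ≤ 1) :
    (inner ℂ φ (τ.op A φ)).re ≤ ‖τ.op B‖ :=
  calc (inner ℂ φ (τ.op A φ)).re ≤ (inner ℂ φ (τ.op B φ)).re := τ.re_inner_op_mono hA hB hAB φ
    _ ≤ ‖φ‖ * ‖τ.op B φ‖ := (Complex.re_le_norm _).trans (norm_inner_le_norm _ _)
    _ ≤ ‖φ‖ * (‖τ.op B‖ * ‖φ‖) := by gcongr; exact (τ.op B).le_opNorm φ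
    _ = ‖τ.op B‖ * ‖φ‖ ^ 2 := by ring
    _ ≤ ‖τ.op B‖ := mul_le_of_le_one_right (norm_nonneg _) hφ

end POVMeasure

/-! ### Limits of densities -/

theorem continuous_lorentzDot :
    Continuous fun p : FourVector × FourVector => lorentzDot p.1 p.2 := by
  unfold lorentzDot
  fun_prop

/-- The integral over the region `B` of the (unnormalized) density of the state with profile `f` and
with the kernel `K`. -/
noncomputable def regionIntegral (B : Set FourVector) (f : FourVector → ℂ)
    (K : FourVector → FourVector → ℂ) : ℂ :=
  ∫ x in B, ∫ k', ∫ k, Complex.exp (Complex.I * (lorentzDot x (k' - k) : ℝ)) *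
    (K k' k * (conj (f k') * f k))

section Limits

variable {B : Set FourVector} {f : FourVector → ℂ} {K : FourVector → FourVector → ℂ}

theorem norm_regionIntegrand (x k' k : FourVector) (z : ℂ) :
    ‖Complex.exp (Complex.I * (lorentzDot x (k' - k) : ℝ)) * (z * (conj (f k') * f k))‖ =
      ‖z‖ * (‖f k'‖ * ‖f k‖) := by
  rw [norm_mul, mul_comm Complex.I, Complex.norm_exp_ofReal_mul_I, one_mul, norm_mul, norm_mul,
    RCLike.norm_conj]

theorem measurable_regionIntegrand (hfm : Measurable f) (hK : Measurable (Function.uncurry K)) :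
    Measurable fun q : FourVector × (FourVector × FourVector) =>
      Complex.exp (Complex.I * (lorentzDot q.1 (q.2.1 - q.2.2) : ℝ)) *
        (K q.2.1 q.2.2 * (conj (f q.2.1) * f q.2.2)) := by
  have h1 : Measurable fun q : FourVector × (FourVector × FourVector) =>
      lorentzDot q.1 (q.2.1 - q.2.2) := by
    have h : Continuous fun q : FourVector × (FourVector × FourVector) =>
        lorentzDot q.1 (q.2.1 - q.2.2) :=
      continuous_lorentzDot.comp
        (continuous_fst.prodMk ((continuous_fst.comp continuous_snd).sub
          (continuous_snd.comp continuous_snd)))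
    exact h.measurable
  have h2 : Measurable fun q : FourVector × (FourVector × FourVector) => K q.2.1 q.2.2 :=
    hK.comp measurable_snd
  have h3 : Measurable fun q : FourVector × (FourVector × FourVector) => conj (f q.2.1) :=
    Complex.continuous_conj.measurable.comp (hfm.comp (measurable_fst.comp measurable_snd))
  have h4 : Measurable fun q : FourVector × (FourVector × FourVector) => f q.2.2 :=
    hfm.comp (measurable_snd.comp measurable_snd)
  exact (Complex.measurable_exp.comp ((Complex.measurable_ofReal.comp h1).const_mul _)).mul
    (h2.mul (h3.mul h4))

theorem integrable_regionBound (hf : Integrable f) (hB : volume B ≠ ∞) :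
    Integrable (fun q : FourVector × (FourVector × FourVector) => ‖f q.2.1‖ * ‖f q.2.2‖)
      ((volume.restrict B).prod volume) := by
  have : IsFiniteMeasure (volume.restrict B) := ⟨by simpa using hB.lt_top⟩
  exact (hf.norm.mul_prod hf.norm).comp_snd _

theorem ae_prod_of_ae {p : FourVector × FourVector → Prop} (h : ∀ᵐ q, p q) :
    ∀ᵐ q ∂((volume.restrict B).prod (volume : Measure (FourVector × FourVector))), p q.2 :=
  Measure.quasiMeasurePreserving_snd.ae h

theorem regionIntegral_eq (hfm : Measurable f) (hf : Integrable f) (hB : volume B ≠ ∞)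
    (hK : Measurable (Function.uncurry K))
    (hK1 : ∀ᵐ q : FourVector × FourVector, ‖K q.1 q.2‖ ≤ 1) :
    regionIntegral B f K = ∫ q, Complex.exp (Complex.I * (lorentzDot q.1 (q.2.1 - q.2.2) : ℝ)) *
        (K q.2.1 q.2.2 * (conj (f q.2.1) * f q.2.2))
          ∂((volume.restrict B).prod (volume : Measure (FourVector × FourVector))) := by
  have hm := measurable_regionIntegrand hfm hK
  have hint : Integrable (fun q : FourVector × (FourVector × FourVector) =>
      Complex.exp (Complex.I * (lorentzDot q.1 (q.2.1 - q.2.2) : ℝ)) *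
        (K q.2.1 q.2.2 * (conj (f q.2.1) * f q.2.2)))
      ((volume.restrict B).prod (volume : Measure (FourVector × FourVector))) := by
    refine (integrable_regionBound hf hB).mono' hm.aestronglyMeasurable ?_
    filter_upwards [ae_prod_of_ae (B := B) hK1] with q hq
    rw [norm_regionIntegrand]
    exact mul_le_of_le_one_left (by positivity) hq
  rw [integral_prod _ hint, regionIntegral]
  congr 1
  ext x
  refine (integral_prod (fun p : FourVector × FourVector =>
    Complex.exp (Complex.I * (lorentzDot x (p.1 - p.2) : ℝ)) *
        (K p.1 p.2 * (conj (f p.1) * f p.2))) ?_).symm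
  refine (hf.norm.mul_prod hf.norm).mono'
    (hm.comp (measurable_const.prodMk measurable_id)).aestronglyMeasurable ?_
  filter_upwards [hK1] with p hp
  rw [norm_regionIntegrand]
  exact mul_le_of_le_one_left (by positivity) hp

/-- Dominated convergence on the product of `B` and of two copies of momentum space. -/
theorem tendsto_regionIntegral {ι : Type*} {l : Filter ι} [l.IsCountablyGenerated] [l.NeBot]
    {L : ι → FourVector → FourVector → ℂ}
    (hfm : Measurable f) (hf : Integrable f) (hB : volume B ≠ ∞)
    (hL : ∀ i, Measurable (Function.uncurry (L i))) (hK : Measurable (Function.uncurry K))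
    (hL1 : ∀ i, ∀ᵐ q : FourVector × FourVector, ‖L i q.1 q.2‖ ≤ 1)
    (hK1 : ∀ᵐ q : FourVector × FourVector, ‖K q.1 q.2‖ ≤ 1)
    (hlim : ∀ᵐ q : FourVector × FourVector,
      Tendsto (fun i => L i q.1 q.2) l (𝓝 (K q.1 q.2))) :
    Tendsto (fun i => regionIntegral B f (L i)) l (𝓝 (regionIntegral B f K)) := by
  rw [regionIntegral_eq hfm hf hB hK hK1]
  simp only [fun i => regionIntegral_eq hfm hf hB (hL i) (hL1 i)]
  refine tendsto_integral_filter_of_dominated_convergence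
    (fun q : FourVector × (FourVector × FourVector) => ‖f q.2.1‖ * ‖f q.2.2‖)
    (Eventually.of_forall fun i => (measurable_regionIntegrand hfm (hL i)).aestronglyMeasurable)
    (Eventually.of_forall fun i => ?_) (integrable_regionBound hf hB) ?_
  · filter_upwards [ae_prod_of_ae (B := B) (hL1 i)] with q hq
    rw [norm_regionIntegrand]
    exact mul_le_of_le_one_left (by positivity) hq
  · filter_upwards [ae_prod_of_ae (B := B) hlim] with q hq
    exact (hq.mul_const _).const_mul _

/-- For the constant kernel the density is the square of the absolute value of the Fourier
transform of the profile. -/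
theorem regionIntegral_one :
    regionIntegral B f (fun _ _ => 1) =
      ((∫ x in B, ‖∫ k, Complex.exp (-(Complex.I * (lorentzDot x k : ℝ))) * f k‖ ^ 2 : ℝ) : ℂ) := by
  rw [regionIntegral, ← integral_complex_ofReal]
  congr 1
  ext x
  have h : ∀ k' k, Complex.exp (Complex.I * (lorentzDot x (k' - k) : ℝ)) *
      (1 * (conj (f k') * f k)) = conj (Complex.exp (-(Complex.I * (lorentzDot x k' : ℝ))) * f k') *
        (Complex.exp (-(Complex.I * (lorentzDot x k : ℝ))) * f k) := by
    intro k' k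
    have hsub : lorentzDot x (k' - k) = lorentzDot x k' - lorentzDot x k := by
      simp [lorentzDot]; ring
    rw [hsub, map_mul, ← Complex.exp_conj]
    simp only [map_neg, map_mul, Complex.conj_I, Complex.conj_ofReal]
    rw [show Complex.I * ((lorentzDot x k' - lorentzDot x k : ℝ) : ℂ) =
      -(-Complex.I * (lorentzDot x k' : ℝ)) + -(Complex.I * (lorentzDot x k : ℝ)) by
        push_cast; ring, Complex.exp_add]
    ring
  simp only [h, integral_const_mul, integral_mul_const]
  rw [integral_conj, Complex.conj_mul']
  push_cast
  rfl

end Limits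

/-! ### Gaussian profiles -/

theorem integral_gaussian_fourVector (b : ℝ) (hb : 0 < b) :
    ∫ y : FourVector, Real.exp (-∑ i, b * y i ^ 2) = (Real.pi / b) ^ 2 := by
  have h := integral_fintype_prod_volume_eq_pow (ι := Fin 4) fun t : ℝ => Real.exp (-b * t ^ 2)
  simp only [integral_gaussian, Fintype.card_fin] at h
  simp only [← Finset.sum_neg_distrib, Real.exp_sum, ← neg_mul]
  rw [h, show (4 : ℕ) = 2 * 2 from rfl, pow_mul, Real.sq_sqrt (by positivity)]

theorem integrable_gaussian_fourVector (b : ℝ) (hb : 0 < b) :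
    Integrable fun y : FourVector => Real.exp (-∑ i, b * y i ^ 2) :=
  not_imp_comm.1 integral_undef (by
    rw [integral_gaussian_fourVector b hb]
    positivity)

/-- The four-vector with lowered indices. -/
def lower (x : FourVector) : FourVector := ![x 0, -x 1, -x 2, -x 3]

theorem lorentzDot_eq_sum_lower (x k : FourVector) : lorentzDot x k = ∑ i, lower x i * k i := by
  simp [lorentzDot, lower, Fin.sum_univ_four]
  ring

/-- A normalized Gaussian profile centred at the origin of momentum space, with a phase that
localizes its Fourier transform at `x₀`. -/
noncomputable def gaussProfile (b : ℝ) (x₀ k : FourVector) : ℂ :=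
  (2 * b / Real.pi : ℝ) *
    Complex.exp (-∑ i, (b : ℂ) * (k i : ℂ) ^ 2 + ∑ i, Complex.I * (lower x₀ i : ℂ) * (k i : ℂ))

theorem continuous_gaussProfile (b : ℝ) (x₀ : FourVector) : Continuous (gaussProfile b x₀) := by
  unfold gaussProfile
  fun_prop

theorem norm_gaussProfile {b : ℝ} (hb : 0 < b) (x₀ k : FourVector) :
    ‖gaussProfile b x₀ k‖ = 2 * b / Real.pi * Real.exp (-∑ i, b * k i ^ 2) := by
  have hre : (-∑ i, (b : ℂ) * (k i : ℂ) ^ 2 + ∑ i, Complex.I * (lower x₀ i : ℂ) * (k i : ℂ)).re =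
      -∑ i, b * k i ^ 2 := by
    have e1 : ∑ i, (b : ℂ) * (k i : ℂ) ^ 2 = ((∑ i, b * k i ^ 2 : ℝ) : ℂ) := by push_cast; rfl
    have e2 : ∑ i, Complex.I * (lower x₀ i : ℂ) * (k i : ℂ) =
        Complex.I * ((∑ i, lower x₀ i * k i : ℝ) : ℂ) := by
      push_cast
      rw [Finset.mul_sum]
      exact Finset.sum_congr rfl fun i _ => by ring
    rw [e1, e2, Complex.add_re, Complex.neg_re, Complex.ofReal_re, Complex.I_mul_re,
      Complex.ofReal_im, neg_zero, add_zero]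
  have := Real.pi_pos
  rw [gaussProfile, norm_mul, Complex.norm_exp, hre, Complex.norm_real,
    Real.norm_of_nonneg (by positivity)]

theorem integrable_gaussProfile {b : ℝ} (hb : 0 < b) (x₀ : FourVector) :
    Integrable (gaussProfile b x₀) :=
  ((integrable_gaussian_fourVector b hb).const_mul (2 * b / Real.pi)).mono'
    (continuous_gaussProfile b x₀).aestronglyMeasurable
    (ae_of_all _ fun k => (norm_gaussProfile hb x₀ k).le)

theorem norm_gaussProfile_sq {b : ℝ} (hb : 0 < b) (x₀ k : FourVector) :
    ‖gaussProfile b x₀ k‖ ^ 2 =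
      (2 * b / Real.pi) ^ 2 * Real.exp (-∑ i, 2 * b * k i ^ 2) := by
  rw [norm_gaussProfile hb, mul_pow, ← Real.exp_nat_mul]
  congr 2
  push_cast
  rw [mul_neg, Finset.mul_sum]
  simp only [mul_assoc]

theorem integral_norm_gaussProfile_sq {b : ℝ} (hb : 0 < b) (x₀ : FourVector) :
    ∫ k, ‖gaussProfile b x₀ k‖ ^ 2 = 1 := by
  simp only [norm_gaussProfile_sq hb]
  rw [integral_const_mul, integral_gaussian_fourVector (2 * b) (by positivity)]
  have := Real.pi_pos
  field_simp

theorem memLp_gaussProfile {b : ℝ} (hb : 0 < b) (x₀ : FourVector) :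
    MemLp (gaussProfile b x₀) 2 := by
  rw [memLp_two_iff_integrable_sq_norm (continuous_gaussProfile b x₀).aestronglyMeasurable]
  exact not_imp_comm.1 integral_undef (by
    rw [integral_norm_gaussProfile_sq hb]
    exact one_ne_zero)

theorem norm_fourier_gaussProfile_sq {b : ℝ} (hb : 0 < b) (x₀ x : FourVector) :
    ‖∫ k, Complex.exp (-(Complex.I * (lorentzDot x k : ℝ))) * gaussProfile b x₀ k‖ ^ 2 =
      (2 * Real.pi / b) ^ 2 * Real.exp (-∑ i, (2 * b)⁻¹ * (x i - x₀ i) ^ 2) := by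
  have h1 : ∀ k : FourVector,
      Complex.exp (-(Complex.I * (lorentzDot x k : ℝ))) * gaussProfile b x₀ k =
      (2 * b / Real.pi : ℝ) * Complex.exp (-∑ i, (b : ℂ) * (k i : ℂ) ^ 2 +
        ∑ i, (Complex.I * ((lower x₀ i - lower x i : ℝ) : ℂ)) * (k i : ℂ)) := by
    intro k
    rw [gaussProfile, mul_left_comm, ← Complex.exp_add, lorentzDot_eq_sum_lower]
    congr 2
    push_cast
    rw [Finset.mul_sum, add_left_comm, ← Finset.sum_neg_distrib, ← Finset.sum_neg_distrib,
      ← Finset.sum_add_distrib]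
    congr 1
    exact Finset.sum_congr rfl fun i _ => by ring
  simp only [h1]
  rw [integral_const_mul, GaussianFourier.integral_cexp_neg_sum_mul_add
    (b := fun _ : Fin 4 => (b : ℂ)) (fun _ => by simpa using hb), norm_mul, norm_prod,
    Complex.norm_real, Real.norm_of_nonneg (by have := Real.pi_pos; positivity), mul_pow, ← Finset.prod_pow]
  have h2 : ∀ i, ‖((Real.pi : ℂ) / b) ^ (1 / 2 : ℂ) *
      Complex.exp ((Complex.I * ((lower x₀ i - lower x i : ℝ) : ℂ)) ^ 2 / (4 * b))‖ ^ 2 =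
      Real.pi / b * Real.exp (-((2 * b)⁻¹ * (x i - x₀ i) ^ 2)) := by
    intro i
    have hpb : 0 < Real.pi / b := div_pos Real.pi_pos hb
    have e1 : ((Real.pi : ℂ) / b) = ((Real.pi / b : ℝ) : ℂ) := by push_cast; rfl
    have e2 : (Complex.I * ((lower x₀ i - lower x i : ℝ) : ℂ)) ^ 2 / (4 * b) =
        ((-(lower x₀ i - lower x i) ^ 2 / (4 * b) : ℝ) : ℂ) := by
      rw [mul_pow, Complex.I_sq]
      push_cast
      ring
    have e3 : (lower x₀ i - lower x i) ^ 2 = (x i - x₀ i) ^ 2 := by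
      fin_cases i <;> simp [lower] <;> ring
    rw [norm_mul, mul_pow, e1, Complex.norm_cpow_eq_rpow_re_of_pos hpb, e2, Complex.norm_exp,
      Complex.ofReal_re, e3, ← Real.rpow_natCast, ← Real.rpow_mul hpb.le, ← Real.exp_nat_mul]
    congr 1
    · norm_num
    · congr 1
      field_simp
      push_cast
      ring
  simp only [h2]
  rw [Finset.prod_mul_distrib, ← Real.exp_sum, Finset.sum_neg_distrib, ← mul_assoc]
  congr 1
  simp only [Finset.prod_const, Finset.card_univ, Fintype.card_fin]
  have := Real.pi_pos
  field_simp

/-- The Fourier transforms of wide Gaussian profiles are concentrated near `x₀`. -/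
theorem tendsto_setIntegral_fourier_gaussProfile (x₀ : FourVector) {r : ℝ} (hr : 0 < r) :
    Tendsto (fun n : ℕ => ((2 * Real.pi) ^ 4)⁻¹ * ∫ x in Metric.ball x₀ r,
      ‖∫ k, Complex.exp (-(Complex.I * (lorentzDot x k : ℝ))) *
        gaussProfile (((n : ℝ) + 1) ^ 2)⁻¹ x₀ k‖ ^ 2) atTop (𝓝 1) := by
  set g : FourVector → ℝ := fun y => Real.exp (-∑ i, (1 / 2) * y i ^ 2) with hg
  have hgi : Integrable g := integrable_gaussian_fourVector (1 / 2) (by norm_num)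
  have hg1 : ∫ y, g y = (2 * Real.pi) ^ 2 := by
    rw [hg, integral_gaussian_fourVector (1 / 2) (by norm_num)]
    ring
  have key : ∀ n : ℕ, ((2 * Real.pi) ^ 4)⁻¹ * ∫ x in Metric.ball x₀ r,
      ‖∫ k, Complex.exp (-(Complex.I * (lorentzDot x k : ℝ))) *
        gaussProfile (((n : ℝ) + 1) ^ 2)⁻¹ x₀ k‖ ^ 2 =
      ((2 * Real.pi) ^ 2)⁻¹ * ∫ y in Metric.ball (0 : FourVector) (((n : ℝ) + 1) * r), g y := by
    intro n
    have hn : (0 : ℝ) < (n : ℝ) + 1 := by positivity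
    have e1 : ∀ x : FourVector, ‖∫ k, Complex.exp (-(Complex.I * (lorentzDot x k : ℝ))) *
        gaussProfile (((n : ℝ) + 1) ^ 2)⁻¹ x₀ k‖ ^ 2 =
        (2 * Real.pi) ^ 2 * ((n : ℝ) + 1) ^ 4 * g (((n : ℝ) + 1) • (x - x₀)) := by
      intro x
      rw [norm_fourier_gaussProfile_sq (by positivity), div_inv_eq_mul, mul_pow, ← pow_mul]
      simp only [hg]
      congr 2
      congr 1
      refine Finset.sum_congr rfl fun i _ => ?_
      simp only [Pi.smul_apply, Pi.sub_apply, smul_eq_mul]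
      field_simp
    have e2 : ∫ x in Metric.ball x₀ r, g (((n : ℝ) + 1) • (x - x₀)) =
        ∫ x in Metric.ball (0 : FourVector) r, g (((n : ℝ) + 1) • x) := by
      rw [← integral_indicator Metric.isOpen_ball.measurableSet,
        ← integral_indicator Metric.isOpen_ball.measurableSet,
        ← integral_add_right_eq_self _ x₀]
      congr 1
      ext x
      simp only [Set.indicator, Metric.mem_ball, dist_eq_norm, sub_zero,
        add_sub_cancel_right]
    simp only [e1]
    rw [integral_const_mul, e2, Measure.setIntegral_comp_smul_of_pos _ _ _ hn, smul_ball hn.ne',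
      smul_zero, Real.norm_of_nonneg hn.le, Module.finrank_fin_fun, smul_eq_mul]
    have := Real.pi_pos
    field_simp
  -- The rescaled balls exhaust the space.
  simp only [key]
  have hU : ⋃ n : ℕ, Metric.ball (0 : FourVector) (((n : ℝ) + 1) * r) = Set.univ := by
    refine Set.eq_univ_of_forall fun y => Set.mem_iUnion.2 ?_
    obtain ⟨n, hn⟩ := exists_nat_gt (‖y‖ / r)
    refine ⟨n, ?_⟩
    rw [mem_ball_zero_iff]
    rw [div_lt_iff₀ hr] at hn
    nlinarith
  have hlim := tendsto_setIntegral_of_monotone (μ := volume) (f := g)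
    (s := fun n : ℕ => Metric.ball (0 : FourVector) (((n : ℝ) + 1) * r))
    (fun n => Metric.isOpen_ball.measurableSet)
    (fun m n hmn => Metric.ball_subset_ball (by gcongr)) hgi.integrableOn
  rw [hU, setIntegral_univ, hg1] at hlim
  have h := hlim.const_mul ((2 * Real.pi) ^ 2)⁻¹
  rwa [inv_mul_cancel₀ (by have := Real.pi_pos; positivity)] at h

namespace QuasiBaricentricData

variable {S N : Type*} (Q : QuasiBaricentricData S N)

/-! ### Test states of large energy -/

theorem measurable_kernel [Countable S] [Countable N] (J : ℕ) {c : S → ℝ → ℂ}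
    (hc : ∀ σ, Measurable (c σ)) : Measurable (Function.uncurry (Q.kernel J c)) := by
  have h1 : Measurable fun p : FourVector × FourVector =>
      repD J ((coneBoost p.1)⁻¹ * coneBoost p.2) 0 0 :=
    measurable_repD J (measurable_inv_mul
      (fun i i' => (measurable_coneBoost i i').comp measurable_fst)
      (fun i i' => (measurable_coneBoost i i').comp measurable_snd))
  have hm : Measurable fun p : FourVector × FourVector => (mass p.1, mass p.2) :=
    (measurable_mass.comp measurable_fst).prodMk (measurable_mass.comp measurable_snd)
  have h2 := (Q.measurable_rHat J hc).comp hm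
  have h3 := h1.mul h2
  exact h3

/-- The part of the future cone where the mass exceeds `M`. -/
def heavyCone (M : ℝ) : Set FourVector := {k ∈ futureCone | M < mass k}

theorem measurableSet_heavyCone (M : ℝ) : MeasurableSet (heavyCone M) :=
  measurableSet_futureCone.inter (measurable_mass measurableSet_Ioi)

open Classical in
/-- The kernel restricted to large masses and translated to large energies. -/
noncomputable def shiftedKernel (M : ℝ) (J : ℕ) (c : S → ℝ → ℂ) (n : ℕ) (k' k : FourVector) : ℂ :=
  if k' + restMomentum n ∈ heavyCone M ∧ k + restMomentum n ∈ heavyCone M then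
    Q.kernel J c (k' + restMomentum n) (k + restMomentum n) else 0

/-- The profile `f`, translated to large energies and restricted to large masses. -/
noncomputable def shiftedProfile (M : ℝ) (f : FourVector → ℂ) (n : ℕ) : FourVector → ℂ :=
  (heavyCone M).indicator fun k => f (k - restMomentum n)

theorem measurable_shiftedKernel [Countable S] [Countable N] (M : ℝ) (J : ℕ) {c : S → ℝ → ℂ}
    (hc : ∀ σ, Measurable (c σ)) (n : ℕ) :
    Measurable (Function.uncurry (Q.shiftedKernel M J c n)) := by
  have h1 : Measurable fun p : FourVector × FourVector => p.1 + restMomentum n :=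
    measurable_fst.add_const _
  have h2 : Measurable fun p : FourVector × FourVector => p.2 + restMomentum n :=
    measurable_snd.add_const _
  have h3 := (Q.measurable_kernel J hc).comp (h1.prodMk h2)
  have h4 := (h1 (measurableSet_heavyCone M)).inter (h2 (measurableSet_heavyCone M))
  convert h3.indicator h4 using 1
  ext p
  by_cases hp : p ∈ (fun p : FourVector × FourVector => p.1 + restMomentum n) ⁻¹' heavyCone M ∩
      (fun p : FourVector × FourVector => p.2 + restMomentum n) ⁻¹' heavyCone M
  · rw [Set.indicator_of_mem hp]
    exact if_pos hp
  · rw [Set.indicator_of_notMem hp]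
    exact if_neg hp

/-- Almost all pairs of vectors of the cone have masses at which `F` is a contraction. -/
theorem ae_isContractive_shift (J : ℕ) (v : FourVector) :
    ∀ᵐ q : FourVector × FourVector,
      (q.1 + v ∈ futureCone → Q.IsContractive J (mass (q.1 + v))) ∧
      (q.2 + v ∈ futureCone → Q.IsContractive J (mass (q.2 + v))) := by
  have h : ∀ᵐ k : FourVector, k + v ∈ futureCone → Q.IsContractive J (mass (k + v)) :=
    (measurePreserving_add_right volume v).quasiMeasurePreserving.ae (ae_mass (Q.contraction J))
  filter_upwards [Measure.quasiMeasurePreserving_fst.ae h, Measure.quasiMeasurePreserving_snd.ae h]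
    with q h1 h2 using ⟨h1, h2⟩

section

variable {Q} {M : ℝ} {J : ℕ} {c : S → ℝ → ℂ} {f : FourVector → ℂ}

theorem isProfile_shiftedProfile (hM : ∀ μ, M < μ → HasSum (fun σ => ‖c σ μ‖ ^ 2) 1)
    (hfm : Measurable f) (hf : Integrable f) (hf2 : MemLp f 2) (n : ℕ) :
    IsProfile c (shiftedProfile M f n) where
  measurable := (hfm.comp (measurable_id.sub_const _)).indicator (measurableSet_heavyCone M)
  integrable := (hf.comp_sub_right _).indicator (measurableSet_heavyCone M)
  memLp := (hf2.comp_measurePreserving (measurePreserving_sub_right volume _)).indicator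
    (measurableSet_heavyCone M)
  mem_cone _ hk := (Set.mem_of_indicator_ne_zero hk).1
  hasSum _ hk := hM _ (Set.mem_of_indicator_ne_zero hk).2

theorem integral_norm_shiftedProfile_sq_le (hf2 : MemLp f 2) (n : ℕ) :
    ∫ k, ‖shiftedProfile M f n k‖ ^ 2 ≤ ∫ k, ‖f k‖ ^ 2 := by
  rw [← integral_sub_right_eq_self (fun k => ‖f k‖ ^ 2) (restMomentum n)]
  refine integral_mono_of_nonneg (ae_of_all _ fun k => by positivity)
    ((hf2.integrable_norm_pow two_ne_zero).comp_sub_right _) (ae_of_all _ fun k => ?_)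
  exact pow_le_pow_left₀ (norm_nonneg _) (norm_indicator_le_norm_self _ _) 2

/-- The translation in momentum space is undone by a change of variables, which does not affect the
exponential. -/
theorem integral_density_wave [Countable S] (hc : ∀ σ, Measurable (c σ))
    (hc0 : ∀ σ μ, μ ∉ Q.spectrum J σ → c σ μ = 0) {n : ℕ} (s : Finset S)
    (hh : IsProfile c (shiftedProfile M f n)) (B : Set FourVector) :
    ∫ x in B, Q.density (wave J s hc hh) x = ((2 * Real.pi) ^ 4 : ℂ)⁻¹ *
      regionIntegral B f (Q.shiftedKernel M J (cutoff s c) n) := by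
  simp only [density_wave hc hc0 hh]
  rw [integral_const_mul, regionIntegral]
  congr 2
  ext x
  rw [← integral_add_right_eq_self _ (restMomentum n)]
  congr 1
  ext k'
  rw [← integral_add_right_eq_self _ (restMomentum n)]
  congr 1
  ext k
  rw [add_sub_add_right_eq_sub, shiftedKernel]
  by_cases hk' : k' + restMomentum n ∈ heavyCone M
  · by_cases hk : k + restMomentum n ∈ heavyCone M
    · simp [shiftedProfile, hk, hk']
    · simp [shiftedProfile, hk]
  · simp [shiftedProfile, hk']

theorem norm_kernel_le (J : ℕ) (c : S → ℝ → ℂ) (k' k : FourVector) :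
    ‖Q.kernel J c k' k‖ ≤ ‖Q.rHat J c (mass k') (mass k)‖ := by
  rw [kernel, norm_mul]
  exact mul_le_of_le_one_left (norm_nonneg _) (norm_repD_le_one J _)

theorem norm_shiftedKernel_cutoff_le (hc0 : ∀ σ μ, μ ∉ Q.spectrum J σ → c σ μ = 0)
    (hM : ∀ μ, M < μ → HasSum (fun σ => ‖c σ μ‖ ^ 2) 1) (n : ℕ) :
    ∀ᵐ q : FourVector × FourVector, ∀ s,
      ‖Q.shiftedKernel M J (cutoff s c) n q.1 q.2‖ ≤ 1 := by
  filter_upwards [Q.ae_isContractive_shift J (restMomentum n)] with q hq s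
  unfold shiftedKernel
  split_ifs with hcone
  · obtain ⟨h', h⟩ := hcone
    exact (norm_kernel_le J _ _ _).trans
      (norm_rHat_cutoff_le hc0 (hq.1 h'.1) (hq.2 h.1) (hM _ h'.2) (hM _ h.2) s)
  · simp

theorem tendsto_shiftedKernel_cutoff (hc0 : ∀ σ μ, μ ∉ Q.spectrum J σ → c σ μ = 0)
    (hM : ∀ μ, M < μ → HasSum (fun σ => ‖c σ μ‖ ^ 2) 1) (n : ℕ) :
    ∀ᵐ q : FourVector × FourVector,
      Tendsto (fun s => Q.shiftedKernel M J (cutoff s c) n q.1 q.2) atTop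
        (𝓝 (Q.shiftedKernel M J c n q.1 q.2)) := by
  filter_upwards [Q.ae_isContractive_shift J (restMomentum n)] with q hq
  unfold shiftedKernel
  split_ifs with hcone
  · obtain ⟨h', h⟩ := hcone
    exact (tendsto_rHat_cutoff hc0 (hq.1 h'.1) (hq.2 h.1) (hM _ h'.2) (hM _ h.2)).const_mul _
  · exact tendsto_const_nhds

theorem norm_shiftedKernel_le (hc0 : ∀ σ μ, μ ∉ Q.spectrum J σ → c σ μ = 0)
    (hM : ∀ μ, M < μ → HasSum (fun σ => ‖c σ μ‖ ^ 2) 1) (n : ℕ) :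
    ∀ᵐ q : FourVector × FourVector, ‖Q.shiftedKernel M J c n q.1 q.2‖ ≤ 1 := by
  filter_upwards [norm_shiftedKernel_cutoff_le hc0 hM n, tendsto_shiftedKernel_cutoff hc0 hM n]
    with q h1 h2
  exact le_of_tendsto h2.norm (Eventually.of_forall h1)

/-- For large energies the two masses are large and their difference is bounded, so that `r̂`
is close to `1`, and the relative boost is close to the unit element. -/
theorem tendsto_shiftedKernel (M : ℝ)
    (hr : ∀ a b : ℝ, TendstoUniformlyOn (fun μ t => Q.rHat J c μ (μ + t)) (fun _ => 1)
        atTop (Set.Icc a b)) (k' k : FourVector) :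
    Tendsto (fun n => Q.shiftedKernel M J c n k' k) atTop (𝓝 1) := by
  -- The uniformity of the limit in `t` is used on an interval around `d`, the limit of `μ - μ'`.
  set d := k 0 - k' 0 with hd
  have hr1 : Tendsto (fun n : ℕ =>
      Q.rHat J c (mass (k' + restMomentum n)) (mass (k + restMomentum n))) atTop (𝓝 1) := by
    rw [Metric.tendsto_nhds]
    intro ε hε
    have h1 := Metric.tendstoUniformlyOn_iff.1 (hr (d - 1) (d + 1)) ε hε
    have h2 := (tendsto_mass_sub k k').eventually (Icc_mem_nhds (sub_one_lt d) (lt_add_one d))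
    filter_upwards [(tendsto_mass_atTop k').eventually h1, h2] with n hn ht
    have := hn _ ht
    rwa [add_sub_cancel, dist_comm] at this
  have h := (tendsto_repD_coneBoost J k k').mul hr1
  rw [one_mul] at h
  refine h.congr' ?_
  filter_upwards [eventually_mem_futureCone k, eventually_mem_futureCone k',
    (tendsto_mass_atTop k).eventually_gt_atTop M, (tendsto_mass_atTop k').eventually_gt_atTop M]
    with n h1 h2 h3 h4
  rw [shiftedKernel, if_pos ⟨⟨h2, h4⟩, ⟨h1, h3⟩⟩, kernel]

/-- The Fourier transform of any normalized profile gives a lower bound for the norm: the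
probability of finding in `B` an event of the test states converges to its integral over `B`,
when first the finite set of the values of `σ` grows, and then the energy tends to infinity. -/
theorem setIntegral_fourier_le_norm [Countable S] [Countable N] {H : Type*} [NormedAddCommGroup H]
    [InnerProductSpace ℂ H] [CompleteSpace H] {W : Q.WaveSpace →ₗᵢ[ℂ] H}
    {τ : POVMeasure FourVector H} (hτ : Q.Describes W τ) (hc : ∀ σ, Measurable (c σ))
    (hc0 : ∀ σ μ, μ ∉ Q.spectrum J σ → c σ μ = 0)
    (hM : ∀ μ, M < μ → HasSum (fun σ => ‖c σ μ‖ ^ 2) 1)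
    (hr : ∀ a b : ℝ, TendstoUniformlyOn (fun μ t => Q.rHat J c μ (μ + t)) (fun _ => 1)
        atTop (Set.Icc a b))
    (hfm : Measurable f) (hf : Integrable f) (hf2 : MemLp f 2) (hf1 : ∫ k, ‖f k‖ ^ 2 = 1)
    {B I : Set FourVector} (hBm : MeasurableSet B) (hB : volume B ≠ ∞) (hI : MeasurableSet I)
    (hBI : B ⊆ I) :
    ((2 * Real.pi) ^ 4)⁻¹ * ∫ x in B,
      ‖∫ k, Complex.exp (-(Complex.I * (lorentzDot x k : ℝ))) * f k‖ ^ 2 ≤ ‖τ.op I‖ := by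
  have hcut : ∀ n s, (((2 * Real.pi) ^ 4 : ℂ)⁻¹ *
      regionIntegral B f (Q.shiftedKernel M J (cutoff s c) n)).re ≤ ‖τ.op I‖ := by
    intro n s
    have hh := isProfile_shiftedProfile hM hfm hf hf2 n
    rw [← integral_density_wave hc hc0 s hh, ← hτ.inner_eq _ (isRegular_wave hc hh) B hBm]
    refine τ.re_inner_op_le hBm hI hBI ?_
    rw [W.norm_map, ← hf1]
    exact (norm_wave_sq_le hc hh).trans (integral_norm_shiftedProfile_sq_le hf2 n)
  have hfull : ∀ n, (((2 * Real.pi) ^ 4 : ℂ)⁻¹ *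
      regionIntegral B f (Q.shiftedKernel M J c n)).re ≤ ‖τ.op I‖ := by
    intro n
    have hlim := tendsto_regionIntegral (l := atTop) hfm hf hB
      (fun s => Q.measurable_shiftedKernel M J (measurable_cutoff s hc) n)
      (Q.measurable_shiftedKernel M J hc n)
      (fun s => (norm_shiftedKernel_cutoff_le hc0 hM n).mono fun q hq => hq s)
      (norm_shiftedKernel_le hc0 hM n) (tendsto_shiftedKernel_cutoff hc0 hM n)
    exact le_of_tendsto ((Complex.continuous_re.tendsto _).comp (hlim.const_mul _))
      (Eventually.of_forall (hcut n))
  have hlim := tendsto_regionIntegral (l := atTop) hfm hf hB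
    (fun n => Q.measurable_shiftedKernel M J hc n)
    (K := fun _ _ => 1) measurable_const (norm_shiftedKernel_le hc0 hM)
    (ae_of_all _ fun q => by simp) (ae_of_all _ fun q => tendsto_shiftedKernel M hr q.1 q.2)
  have h := le_of_tendsto ((Complex.continuous_re.tendsto _).comp
    (hlim.const_mul ((2 * Real.pi) ^ 4 : ℂ)⁻¹)) (Eventually.of_forall hfull)
  rw [regionIntegral_one] at h
  rwa [show ((2 * Real.pi : ℂ) ^ 4)⁻¹ = ((((2 * Real.pi) ^ 4)⁻¹ : ℝ) : ℂ) by push_cast; rfl,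
    ← Complex.ofReal_mul, Complex.ofReal_re] at h

end

end QuasiBaricentricData

end EventPOV

theorem proposition6 {S N : Type*} [Countable S] [Countable N]
    {H : Type*} [NormedAddCommGroup H] [InnerProductSpace ℂ H] [CompleteSpace H]
    (Q : EventPOV.QuasiBaricentricData S N) (W : Q.WaveSpace →ₗᵢ[ℂ] H)
    (τ : EventPOV.POVMeasure EventPOV.FourVector H) (hτ : Q.Describes W τ)
    (hr : ∃ (J : ℕ) (c : S → ℝ → ℂ),
      (∀ σ, Measurable (c σ)) ∧
      (∀ σ μ, μ ∉ Q.spectrum J σ → c σ μ = 0) ∧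
      (∀ᶠ μ in Filter.atTop, HasSum (fun σ => ‖c σ μ‖ ^ 2) 1) ∧
      ∀ a b : ℝ, TendstoUniformlyOn (fun μ t => Q.rHat J c μ (μ + t)) (fun _ => 1)
        Filter.atTop (Set.Icc a b)) :
    τ.IsDefinite := by
  obtain ⟨J, c, hc, hc0, hnorm, hr⟩ := hr
  obtain ⟨M, hM⟩ := Filter.eventually_atTop.1 hnorm
  intro I hI hint
  refine le_antisymm (τ.norm_op_le_one hI) ?_
  obtain ⟨x₀, hx₀⟩ := hint
  obtain ⟨r, hr0, hball⟩ := Metric.isOpen_iff.1 isOpen_interior x₀ hx₀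
  refine le_of_tendsto (EventPOV.tendsto_setIntegral_fourier_gaussProfile x₀ hr0)
    (Eventually.of_forall fun n => ?_)
  have hb : (0 : ℝ) < (((n : ℝ) + 1) ^ 2)⁻¹ := by positivity
  exact EventPOV.QuasiBaricentricData.setIntegral_fourier_le_norm hτ hc hc0
    (fun μ hμ => hM μ hμ.le) hr (EventPOV.continuous_gaussProfile _ x₀).measurable
    (EventPOV.integrable_gaussProfile hb x₀) (EventPOV.memLp_gaussProfile hb x₀)
    (EventPOV.integral_norm_gaussProfile_sq hb x₀) Metric.isOpen_ball.measurableSet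
    measure_ball_lt_top.ne hI (hball.trans interior_subset)
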